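/- Let $\Omega_1,\Omega_2,\Omega_3>0$ and $$\varphi(x_1,x_2,x_3)=\prod_{j=1}^3\frac{\sin(\Omega_jx_j)}{\pi x_j},$$ where the $j$-th factor is $\Omega_j/\pi$ at $x_j=0$. Let $s_0\in(0,1)$, $\overline\tau_j>0$, and let $\tau_j=\tau_j(n_j)>0$ $(j=1,2,3)$ be sampling periods with $n_j\tau_j\to\overline\tau_j$ as $n_j\to\infty$. One observes $$y_{l_1,l_2,l_3}=f(l_1\tau_1,l_2\tau_2,l_3\tau_3)+\varepsilon_{l_1,l_2,l_3},\qquad 1\le l_j\le n_j .$$ The noise $\{\varepsilon_{\boldsymbol i}\}_{\boldsymbol i\in\mathbb Z^3}$ is a weakly stationary random field with $\mathbb E\,\varepsilon_{\boldsymbol i}=0$ that satisfies the functional central limit theorem $$(n_1n_2n_3)^{-1/2}\sum_{i_1=1}^{\lfloor n_1v_1\rfloor}\sum_{i_2=1}^{\lfloor n_2v_2\rfloor}\sum_{i_3=1}^{\lfloor n_3v_3\rfloor}\varepsilon_{i_1,i_2,i_3}\Rightarrow\sigma B(v_1,v_2,v_3)$$ in the Skorohod space $D[0,1]^3$ as $\min_i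 n_i\to\infty$, for some constant $\sigma>0$, where $B$ is a standard Brownian motion (Brownian sheet) on $[0,1]^3$. Assume the null hypothesis $f=f_0$ and that the reference signal $f_0$ is time-constant, $f_0(t,r_2,r_3)=f_0(0,r_2,r_3)$. Both identities are assumed at all points $(t,r_2,r_3)$ of $\prod_j[0,\overline\tau_j]$ and at all sampling points $(l_1\tau_1,l_2\tau_2,l_3\tau_3)$, $1\le l_j\le n_j$ (which may lie outside this box if $n_j\tau_j>\overline\tau_j$). Let $$\overline y_{\cdot,l_2,l_3}=\frac1{\lfloor n_1s_0\rfloor}\sum_{l_1=1}^{\lfloor n_1s_0\rfloor}y_{l_1,l_2,l_3},$$ $$\mathcal F^c_n(s,t,r_2,r_3)=\sqrt{\tau_1\tau_2\tau_3}\sum_{l_1=1}^{\lfloor n_1s\rfloor}\sum_{l_2=1}^{n_2}\sum_{l_3=1}^{n_3}(y_{l_1,l_2,l_3}-\overline y_{\cdot,l_2,l_3})\,\varphi(t-l_1\tau_1,r_2-l_2\tau_2,r_3-l_3\tau_3).$$ Then, as $\min_i n_i\to\infty$, $$\mathcal F^c_n\Rightarrow\mathcal F^c\quad\text{in the Skorohod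 space } D\big([s_0,1]\times[0,\overline\tau_1]\times[0,\overline\tau_2]\times[0,\overline\tau_3]\big),$$ where $$\mathcal F^c(s,t,r_2,r_3)=\sqrt{\overline\tau_1\overline\tau_2\overline\tau_3}\,\sigma\int_0^s\!\int_0^1\!\int_0^1\varphi(t-\overline\tau_1z_1,r_2-\overline\tau_2z_2,r_3-\overline\tau_3z_3)\,\mathrm dB^c(z_1,z_2,z_3),$$ $$B^c(z_1,z_2,z_3)=B(z_1,z_2,z_3)-\frac{z_1}{s_0}B(s_0,z_2,z_3),\qquad z\in[0,1]^3.$$ Almost surely these integrals exist for all $(s,t,r_2,r_3)$ in the above rectangle. Here the integral of a function $g$ of bounded variation against a continuous function $h$ on a rectangle $[a,b]\subset\mathbb R^3$ is defined through integration by parts, $$\int_a^b g\,\mathrm dh=\sum_{v\subseteq\{1,2,3\}}(-1)^{|v|}\sum_{w\subseteq\{1,2,3\}\setminus v}(-1)^{|w|}\int_{[a_v,b_v]}h\,\mathrm dg ,$$ where in the inner multivariate Riemann--Stieltjes integral over the coordinates in $v$ the coordinates in $w$ are fixed at their lower endpoints and the remaining ones at their upper endpoints (for $v=\emptyset$ it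 is the value of $hg$ at that point). The Skorohod space $D$ of a rectangle consists of the functions that are continuous from above and have limits along all quadrants. It carries the Skorohod metric, the infimum over coordinatewise increasing bijective time changes $\lambda$ of the rectangle of $\max(\sup|x\circ\lambda-y|,\sup\|\lambda-\mathrm{id}\|)$, and $\Rightarrow$ is weak convergence of laws on its Borel $\sigma$-algebra. -/

import Mathlib

open MeasureTheory ProbabilityTheory Filter Set
open scoped Topology ENNReal

noncomputable section

/-! ### The Skorokhod space on a rectangle -/

/-- The closed rectangle `∏ₚ [aₚ, bₚ]` in `ℝ^q`, with the product metric (maximum norm). -/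
abbrev RectBox {q : ℕ} (a b : Fin q → ℝ) : Type := ∀ p : Fin q, Set.Icc (a p) (b p)

/-- The quadrant `{y | yₚ < xₚ for p ∈ R, yₚ ≥ xₚ for p ∉ R}` of the rectangle at the point `x`. -/
def quadrant {q : ℕ} {a b : Fin q → ℝ} (R : Finset (Fin q)) (x : RectBox a b) :
    Set (RectBox a b) :=
  {y | ∀ p, if p ∈ R then y p < x p else x p ≤ y p}

/-- The Skorokhod space `D` of a rectangle: the real functions that have a limit along each of
the `2^q` quadrants at each point and are continuous from above. A quadrant that is empty near
the point imposes no condition. -/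
structure SkorokhodSpace {q : ℕ} (a b : Fin q → ℝ) where
  toFun : RectBox a b → ℝ
  exists_quadrant_limit :
    ∀ (x : RectBox a b) (R : Finset (Fin q)), ∃ L : ℝ, Tendsto toFun (𝓝[quadrant R x] x) (𝓝 L)
  continuous_from_above :
    ∀ x : RectBox a b, Tendsto toFun (𝓝[quadrant ∅ x] x) (𝓝 (toFun x))

namespace SkorokhodSpace

variable {q : ℕ} {a b : Fin q → ℝ}

instance : CoeFun (SkorokhodSpace a b) (fun _ => RectBox a b → ℝ) := ⟨toFun⟩

/-- A coordinatewise change of "time": an increasing bijection of each edge of the rectangle. -/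
abbrev TimeChange (a b : Fin q → ℝ) : Type := ∀ p : Fin q, Set.Icc (a p) (b p) ≃o Set.Icc (a p) (b p)

/-- The action of a coordinatewise change of time on points. -/
def TimeChange.app (l : TimeChange a b) (x : RectBox a b) : RectBox a b := fun p => l p (x p)

/-- The cost of a time change `l` when comparing `f ∘ l` with `g`:
the maximum of `sup |f ∘ l - g|` and `sup ‖l - id‖`. -/
def cost (f g : SkorokhodSpace a b) (l : TimeChange a b) : ℝ≥0∞ :=
  max (⨆ x : RectBox a b, edist (f (l.app x)) (g x)) (⨆ x : RectBox a b, edist (l.app x) x)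

/-- The Skorokhod distance is the infimum over all time changes `l` of
`max (sup |f ∘ l - g|) (sup ‖l - id‖)`. -/
instance : PseudoEMetricSpace (SkorokhodSpace a b) where
  edist f g := ⨅ l : TimeChange a b, cost f g l
  edist_self f := by
    refine le_antisymm ?_ bot_le
    refine iInf_le_of_le (fun p => OrderIso.refl _) ?_
    have h : ∀ x : RectBox a b,
        TimeChange.app (a := a) (b := b) (fun p => OrderIso.refl _) x = x := fun x => rfl
    simp [cost, h]
  edist_comm := by
    have key : ∀ f g : SkorokhodSpace a b,
        (⨅ l : TimeChange a b, cost f g l) ≤ ⨅ l : TimeChange a b, cost g f l := by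
      intro f g
      refine le_iInf fun l => ?_
      have h : ∀ x : RectBox a b, l.app (TimeChange.app (fun p => (l p).symm) x) = x :=
        fun x => funext fun p => (l p).apply_symm_apply (x p)
      refine iInf_le_of_le (fun p => (l p).symm) ?_
      refine max_le_max (iSup_le fun x => ?_) (iSup_le fun x => ?_)
      · refine le_iSup_of_le (TimeChange.app (fun p => (l p).symm) x) ?_
        rw [edist_comm, h]
      · refine le_iSup_of_le (TimeChange.app (fun p => (l p).symm) x) ?_
        rw [edist_comm, h]
    intro f g
    exact le_antisymm (key f g) (key g f)
  edist_triangle f g h := by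
    rw [ENNReal.iInf_add]
    refine le_iInf fun l => ?_
    rw [ENNReal.add_iInf]
    refine le_iInf fun m => ?_
    refine iInf_le_of_le (fun p => (m p).trans (l p)) ?_
    refine max_le (iSup_le fun x => ?_) (iSup_le fun x => ?_)
    · refine (edist_triangle _ (g (m.app x)) _).trans (add_le_add ?_ ?_)
      · exact (le_iSup (fun y => edist (f (l.app y)) (g y)) (m.app x)).trans (le_max_left _ _)
      · exact (le_iSup (fun y => edist (g (m.app y)) (h y)) x).trans (le_max_left _ _)
    · refine (edist_triangle _ (m.app x) _).trans (add_le_add ?_ ?_)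
      · exact (le_iSup (fun y => edist (l.app y) y) (m.app x)).trans (le_max_right _ _)
      · exact (le_iSup (fun y => edist (m.app y) y) x).trans (le_max_right _ _)

instance : MeasurableSpace (SkorokhodSpace a b) := borel _

instance : BorelSpace (SkorokhodSpace a b) := ⟨rfl⟩

end SkorokhodSpace

/-- Weak convergence `Xᵢ ⇒ Y` along `l` in the Skorokhod space of the rectangle `[a, b]`, for
processes `Xᵢ`, `Y` indexed by the points of `ℝ^q` of which only the restriction to `[a, b]`
matters: almost surely the restricted paths are those of random elements of the Skorokhod space,
and the laws of these random elements converge weakly. -/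
def ConvergesWeaklyInSkorokhod {q : ℕ} (a b : Fin q → ℝ) {ι Ω Ω' : Type*}
    [MeasurableSpace Ω] [MeasurableSpace Ω']
    (P : Measure Ω) [IsProbabilityMeasure P] (P' : Measure Ω') [IsProbabilityMeasure P']
    (X : ι → Ω → (Fin q → ℝ) → ℝ) (l : Filter ι) (Y : Ω' → (Fin q → ℝ) → ℝ) : Prop :=
  ∃ (X' : ι → Ω → SkorokhodSpace a b) (Y' : Ω' → SkorokhodSpace a b),
    (∀ i, ∀ᵐ ω ∂P, ∀ x : RectBox a b, X' i ω x = X i ω (fun p => (x p : ℝ))) ∧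
    (∀ᵐ ω ∂P', ∀ x : RectBox a b, Y' ω x = Y ω (fun p => (x p : ℝ))) ∧
    TendstoInDistribution X' l Y' (fun _ => P) P'

/-! ### Alternating sums, ladders and Riemann-Stieltjes integrals -/

/-- The alternating sum `Δ(f; a, b) = ∑_v (-1)^|v| f(a_v : b_{-v})`. -/
def altSum {ι : Type*} [Fintype ι] [DecidableEq ι] (f : (ι → ℝ) → ℝ) (a b : ι → ℝ) : ℝ :=
  ∑ v : Finset ι, (-1 : ℝ) ^ v.card * f (v.piecewise a b)

/-- A ladder on `[a, b]`: a finite set that consists of `a` and of points of `(a, b)`. -/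
def IsLadder (a b : ℝ) (Y : Finset ℝ) : Prop :=
  a ∈ Y ∧ ∀ y ∈ Y, y ≠ a → y ∈ Set.Ioo a b

/-- The successor of `y` in the ladder `Y` on `[a, b]`: the smallest element of `Y` above `y`,
and `b` if there is none. -/
def ladderSucc (b : ℝ) (Y : Finset ℝ) (y : ℝ) : ℝ :=
  (insert b (Y.filter (fun z => y < z))).min' (Finset.insert_nonempty _ _)

/-- The Riemann-Stieltjes integral `∫_a^b h df` exists and equals `I`: the Riemann-Stieltjes sums
`∑_y h(ỹ) Δ(f; y, y⁺)` over product ladders, with arbitrary tags `ỹ ∈ [y, y⁺]`, converge to `I` as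
the mesh tends to zero. -/
def HasRSIntegral {ι : Type*} [Fintype ι] [DecidableEq ι] (a b : ι → ℝ)
    (h f : (ι → ℝ) → ℝ) (I : ℝ) : Prop :=
  ∀ ε > 0, ∃ δ > 0, ∀ (Y : ι → Finset ℝ) (tag : (ι → ℝ) → (ι → ℝ)),
    (∀ j, IsLadder (a j) (b j) (Y j)) →
    (∀ j, ∀ y ∈ Y j, ladderSucc (b j) (Y j) y - y < δ) →
    (∀ y ∈ Fintype.piFinset Y, tag y ∈ Set.Icc y (fun j => ladderSucc (b j) (Y j) (y j))) →
    |∑ y ∈ Fintype.piFinset Y, h (tag y) * altSum f y (fun j => ladderSucc (b j) (Y j) (y j)) - I|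
      < ε

/-- The point `x_v : c_{-v}`, with coordinates `x` on `v` and those of `c` off `v`. -/
def glue {ι : Type*} [DecidableEq ι] (v : Finset ι) (x : v → ℝ) (c : ι → ℝ) : ι → ℝ :=
  fun j => if hj : j ∈ v then x ⟨j, hj⟩ else c j

/-- The multivariate integral `∫_a^b f dh` of a function `f` of bounded variation against a
function `h` that need not be of bounded variation, defined by integration by parts:
`∫ f dh = ∑_v (-1)^|v| ∫_{a_v}^{b_v} [h df]_{a_{-v}}^{b_{-v}}`, where
`∫_{a_v}^{b_v} [h df]_{a_{-v}}^{b_{-v}}` is the alternating sum over `w ⊆ -v` of the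
Riemann-Stieltjes integrals `J v w` over `[a_v, b_v]` of `h` against `f`, the other coordinates
being frozen at `a_w : b_{-v-w}`. For `v = ∅` this is the boundary term `Δ(h f; a, b)`, for `v` the
whole index set it is `∫ h df`. The integral exists when all these Riemann-Stieltjes integrals do,
and then equals `I`. -/
def HasIntegralByParts {ι : Type*} [Fintype ι] [DecidableEq ι] (a b : ι → ℝ)
    (f h : (ι → ℝ) → ℝ) (I : ℝ) : Prop :=
  ∃ J : Finset ι → Finset ι → ℝ,
    (∀ v : Finset ι, ∀ w ⊆ vᶜ,
      HasRSIntegral (fun j : v => a j) (fun j : v => b j)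
        (fun x => h (glue v x (w.piecewise a b))) (fun x => f (glue v x (w.piecewise a b)))
        (J v w)) ∧
    I = ∑ v : Finset ι, (-1 : ℝ) ^ v.card * ∑ w ∈ vᶜ.powerset, (-1 : ℝ) ^ w.card * J v w

/-- Every nonempty rectangle has ladders of arbitrarily small mesh, so that the Riemann-Stieltjes
integral is unique. -/
theorem HasRSIntegral.unique {ι : Type*} [Fintype ι] [DecidableEq ι] {a b : ι → ℝ}
    {h f : (ι → ℝ) → ℝ} {I I' : ℝ} (hab : a ≤ b) (hI : HasRSIntegral a b h f I)
    (hI' : HasRSIntegral a b h f I') : I = I' := by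
  have ladder : ∀ (c d δ : ℝ), c ≤ d → 0 < δ → ∃ Y : Finset ℝ, IsLadder c d Y ∧
      ∀ y ∈ Y, y ≤ ladderSucc d Y y ∧ ladderSucc d Y y - y < δ := by
    intro c d δ hcd hδ
    obtain ⟨N, hN⟩ := exists_nat_gt ((d - c) / δ)
    have hN0 : (0 : ℝ) < N := lt_of_le_of_lt (div_nonneg (by linarith) hδ.le) hN
    have hst : (d - c) / N < δ := by
      rw [div_lt_iff₀ hδ] at hN
      rw [div_lt_iff₀ hN0]
      linarith
    have hst0 : 0 ≤ (d - c) / N := div_nonneg (by linarith) hN0.le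
    have hNd : (N : ℝ) * ((d - c) / N) = d - c := by field_simp
    set e := (d - c) / N
    refine ⟨(Finset.range N).image (fun k : ℕ => c + k * e), ⟨?_, ?_⟩, ?_⟩
    · exact Finset.mem_image.2 ⟨0, Finset.mem_range.2 (by exact_mod_cast hN0), by simp⟩
    · intro y hy hyc
      obtain ⟨k, hk, rfl⟩ := Finset.mem_image.1 hy
      have hk' : (k : ℝ) < N := by exact_mod_cast Finset.mem_range.1 hk
      have hke : (k : ℝ) * e ≠ 0 := fun h0 => hyc (by rw [h0, add_zero])
      have he : 0 < e := lt_of_le_of_ne hst0 (fun h0 => hke (by rw [← h0, mul_zero]))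
      have hk0 : 0 < (k : ℝ) * e := lt_of_le_of_ne (by positivity) (Ne.symm hke)
      constructor
      · linarith
      · nlinarith
    · intro y hy
      obtain ⟨k, hk, rfl⟩ := Finset.mem_image.1 hy
      have hk1 : ((k : ℝ) + 1) ≤ N := by exact_mod_cast Finset.mem_range.1 hk
      have hle : c + ((k : ℝ) + 1) * e ≤ d := by nlinarith
      constructor
      · refine Finset.le_min' _ _ _ fun z hz => ?_
        rcases Finset.mem_insert.1 hz with rfl | hz
        · linarith
        · exact (Finset.mem_filter.1 hz).2.le
      · suffices ladderSucc d ((Finset.range N).image (fun k : ℕ => c + k * e)) (c + k * e)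
            ≤ c + ((k : ℝ) + 1) * e by linarith
        refine Finset.min'_le _ _ ?_
        rcases (Nat.lt_or_ge (k + 1) N) with hlt | hge
        · rcases hst0.eq_or_lt with he | he
          · refine Finset.mem_insert.2 (Or.inl ?_)
            rw [← he] at hNd ⊢
            linarith
          · refine Finset.mem_insert.2 (Or.inr (Finset.mem_filter.2 ⟨?_, by linarith⟩))
            exact Finset.mem_image.2 ⟨k + 1, Finset.mem_range.2 hlt, by push_cast; ring⟩
        · refine Finset.mem_insert.2 (Or.inl ?_)
          have hkN : ((k : ℝ) + 1) = N :=
            le_antisymm hk1 (by exact_mod_cast hge)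
          rw [hkN, hNd]
          ring
  by_contra hne
  have hpos : 0 < |I - I'| / 2 := by
    have := abs_pos.2 (sub_ne_zero.2 hne)
    linarith
  obtain ⟨δ, hδ, h1⟩ := hI _ hpos
  obtain ⟨δ', hδ', h2⟩ := hI' _ hpos
  choose Y hY hY' using fun j => ladder (a j) (b j) (min δ δ') (hab j) (lt_min hδ hδ')
  have htag : ∀ y ∈ Fintype.piFinset Y,
      y ∈ Set.Icc y (fun j => ladderSucc (b j) (Y j) (y j)) := fun y hy =>
    ⟨le_rfl, fun j => (hY' j (y j) (Fintype.mem_piFinset.1 hy j)).1⟩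
  have e1 := h1 Y (fun y => y) hY
    (fun j y hy => (hY' j y hy).2.trans_le (min_le_left _ _)) htag
  have e2 := h2 Y (fun y => y) hY
    (fun j y hy => (hY' j y hy).2.trans_le (min_le_right _ _)) htag
  rw [abs_lt] at e1 e2
  rcases abs_cases (I - I') with ⟨h3, _⟩ | ⟨h3, _⟩ <;> rw [h3] at e1 e2 <;> linarith

/-- The integral that is defined by integration by parts is unique. -/
theorem HasIntegralByParts.unique {ι : Type*} [Fintype ι] [DecidableEq ι] {a b : ι → ℝ}
    {f h : (ι → ℝ) → ℝ} {I I' : ℝ} (hab : a ≤ b) (hI : HasIntegralByParts a b f h I)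
    (hI' : HasIntegralByParts a b f h I') : I = I' := by
  obtain ⟨J, hJ, rfl⟩ := hI
  obtain ⟨J', hJ', rfl⟩ := hI'
  refine Finset.sum_congr rfl fun v _ => ?_
  congr 1
  refine Finset.sum_congr rfl fun w hw => ?_
  have hw' := Finset.mem_powerset.1 hw
  rw [HasRSIntegral.unique (fun j : v => hab j) (hJ v w hw') (hJ' v w hw')]

/-! ### Brownian motion on the unit cube, noise fields -/

/-- The block `∏ⱼ (sⱼ, tⱼ]`. -/
def block {q : ℕ} (s t : Fin q → ℝ) : Set (Fin q → ℝ) :=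
  Set.univ.pi fun j => Set.Ioc (s j) (t j)

/-- `B` is a standard Brownian motion on `[0,1]^q` (Brownian sheet): its paths are almost surely
continuous on `[0,1]^q`, it vanishes where a coordinate is zero, and its increments around pairwise
disjoint blocks are independent and centered normal, with the volumes of the blocks as variances. -/
structure IsBrownianSheet {q : ℕ} {Ω : Type*} [MeasurableSpace Ω] (P : Measure Ω)
    (B : Ω → (Fin q → ℝ) → ℝ) : Prop where
  aemeasurable : ∀ t ∈ Set.Icc (0 : Fin q → ℝ) 1, AEMeasurable (fun ω => B ω t) P
  continuous_paths : ∀ᵐ ω ∂P, ContinuousOn (B ω) (Set.Icc 0 1)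
  zero_on_faces : ∀ᵐ ω ∂P, ∀ t ∈ Set.Icc (0 : Fin q → ℝ) 1, (∃ j, t j = 0) → B ω t = 0
  gaussian_increments : ∀ s t : Fin q → ℝ, 0 ≤ s → s ≤ t → t ≤ 1 →
    HasLaw (fun ω => altSum (B ω) s t) (gaussianReal 0 (volume (block s t)).toNNReal) P
  indep_increments : ∀ (k : ℕ) (s t : Fin k → Fin q → ℝ),
    (∀ i, 0 ≤ s i ∧ s i ≤ t i ∧ t i ≤ 1) →
    (Pairwise fun i i' => Disjoint (block (s i) (t i)) (block (s i') (t i'))) →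
    iIndepFun (fun i ω => altSum (B ω) (s i) (t i)) P

/-- A weakly stationary random field on `ℤ³`. -/
structure IsWeaklyStationary {Ω : Type*} [MeasurableSpace Ω] (P : Measure Ω)
    (ε : (Fin 3 → ℤ) → Ω → ℝ) : Prop where
  memLp : ∀ i, MemLp (ε i) 2 P
  mean_eq : ∀ i k, P[ε (i + k)] = P[ε i]
  cov_eq : ∀ i j k, covariance (ε (i + k)) (ε (j + k)) P = covariance (ε i) (ε j) P

/-- The grid `{1, …, m₀} × {1, …, m₁} × {1, …, m₂}`. -/
def grid (m : Fin 3 → ℕ) : Finset (Fin 3 → ℕ) := Fintype.piFinset fun j => Finset.Icc 1 (m j)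

/-- The normalized partial sum process
`Z_n(v) = (n₁ n₂ n₃)^{-1/2} ∑_{i₁ ≤ ⌊n₁ v₁⌋} ∑_{i₂ ≤ ⌊n₂ v₂⌋} ∑_{i₃ ≤ ⌊n₃ v₃⌋} ε_i` of a random
field. -/
def partialSumProcess {Ω : Type*} (ε : (Fin 3 → ℤ) → Ω → ℝ) (n : Fin 3 → ℕ) (ω : Ω)
    (v : Fin 3 → ℝ) : ℝ :=
  (Real.sqrt (∏ j, (n j : ℝ)))⁻¹ *
    ∑ i ∈ grid (fun j => ⌊(n j : ℝ) * v j⌋₊), ε (fun j => (i j : ℤ)) ω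

/-! ### The sampling model and the detector with estimated reference signal -/

/-- The product reconstruction kernel `φ(x) = ∏ⱼ sin(Ωⱼ xⱼ) / (π xⱼ)`, with the value `Ωⱼ / π` of
the `j`-th factor at `xⱼ = 0`. -/
def reconstructionKernel (Om : Fin 3 → ℝ) (x : Fin 3 → ℝ) : ℝ :=
  ∏ j, if x j = 0 then Om j / Real.pi else Real.sin (Om j * x j) / (Real.pi * x j)

/-- The sampling point `(l₁ τ₁, l₂ τ₂, l₃ τ₃)` for the sample size `n`, where the `j`-th sampling
period is `τⱼ = τ j (n j)`. -/
def samplingPoint (τ : Fin 3 → ℕ → ℝ) (n l : Fin 3 → ℕ) : Fin 3 → ℝ :=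
  fun j => (l j : ℝ) * τ j (n j)

/-- The region on which signals are compared: the box `∏ⱼ [0, τ̄ⱼ]`, together with all the sampling
points, which can lie slightly outside the box because `nⱼ τⱼ` is only asymptotically `τ̄ⱼ`. -/
def signalDomain (τbar : Fin 3 → ℝ) (τ : Fin 3 → ℕ → ℝ) : Set (Fin 3 → ℝ) :=
  Set.Icc 0 τbar ∪ {x | ∃ n : Fin 3 → ℕ, ∃ l ∈ grid n, x = samplingPoint τ n l}

/-- The noisy observations `y_l = f(l₁ τ₁, l₂ τ₂, l₃ τ₃) + ε_l`. -/
def observation {Ω : Type*} (f : (Fin 3 → ℝ) → ℝ) (ε : (Fin 3 → ℤ) → Ω → ℝ)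
    (τ : Fin 3 → ℕ → ℝ) (n : Fin 3 → ℕ) (ω : Ω) (l : Fin 3 → ℕ) : ℝ :=
  f (samplingPoint τ n l) + ε (fun j => (l j : ℤ)) ω

/-- The learning-sample average `ȳ_{·,l₂,l₃} = ⌊n₁ s₀⌋⁻¹ ∑_{k = 1}^{⌊n₁ s₀⌋} y_{k,l₂,l₃}`. -/
def learningAverage (s₀ : ℝ) (n : Fin 3 → ℕ) (y : (Fin 3 → ℕ) → ℝ) (l : Fin 3 → ℕ) : ℝ :=
  (⌊(n 0 : ℝ) * s₀⌋₊ : ℝ)⁻¹ *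
    ∑ k ∈ Finset.Icc 1 ⌊(n 0 : ℝ) * s₀⌋₊, y (Function.update l 0 k)

/-- The centered detector
`F^c_n(s, t, r₂, r₃) = √(τ₁ τ₂ τ₃) ∑_{l₁ ≤ ⌊n₁ s⌋} ∑_{l₂ ≤ n₂} ∑_{l₃ ≤ n₃} (y_l - ȳ_{·,l₂,l₃})
φ(t - l₁ τ₁, r₂ - l₂ τ₂, r₃ - l₃ τ₃)`, at the argument `x = (s, t, r₂, r₃)`, computed from the
observations `y`. -/
def centeredDetector (Om : Fin 3 → ℝ) (s₀ : ℝ) (τ : Fin 3 → ℕ → ℝ) (n : Fin 3 → ℕ)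
    (y : (Fin 3 → ℕ) → ℝ) (x : Fin 4 → ℝ) : ℝ :=
  Real.sqrt (∏ j, τ j (n j)) *
    ∑ l ∈ grid ![⌊(n 0 : ℝ) * x 0⌋₊, n 1, n 2],
      (y l - learningAverage s₀ n y l) *
        reconstructionKernel Om (fun j => x j.succ - samplingPoint τ n l j)

/-- The bridged sheet `B^c(z) = B(z₁, z₂, z₃) - (z₁ / s₀) B(s₀, z₂, z₃)`. -/
def bridgedSheet (s₀ : ℝ) (B : (Fin 3 → ℝ) → ℝ) (z : Fin 3 → ℝ) : ℝ :=
  B z - z 0 / s₀ * B (Function.update z 0 s₀)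

end

/-! Under the null hypothesis the signal does not depend on the first coordinate, so subtracting the
learning average removes it and the detector is a function of the noise alone. The partial sums of
the centered noise are `S(z) - (⌊n₁z₁⌋/⌊n₁s₀⌋) S(s₀, z₂, z₃)`, the discrete form of the bridge
(`stepSum_centeredArray`). Since `l_j τ_j = (n_j τ_j)(l_j / n_j)`, multivariate summation by parts
(`byPartsIntegral_stepSum`) writes the detector exactly as `kernelIntegral` of this step function,
with parameters `c_j = n_j τ_j` (`centeredDetector_eq_byPartsIntegral`). The limit is the same
functional of the bridged Brownian sheet, with `c = τbar`.

Integration by parts puts all derivatives on the smooth kernel, so the functional is Lipschitz in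
the integrator for the uniform norm (`exists_abs_kernelIntegral_sub_le`) and jointly continuous in
`c` and `x` (`continuousOn_kernelIntegral`). Hence partial sums uniformly close to a continuous path
give, for large `n`, a detector uniformly close to the limit functional of that path
(`exists_abs_centeredDetector_sub_le`).

The functional varies with `n` and is controlled only near continuous paths, so weak convergence is
transferred by an extended continuous mapping theorem (`tendstoInDistribution_of_forall_isOpen`).
Path continuity of the sheet turns Skorokhod closeness into uniform closeness; its vanishing on the
lower faces removes the boundary terms there. -/

noncomputable section

/-! ### Convergence in distribution of approximate functionals -/

/-- An extended continuous mapping theorem. Suppose that `X i` converges in distribution to `Z`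
and that, whenever `X i` is close to the value `Z ω'`, the variable `Y i` is eventually close to
`W ω'`. Then `Y i` converges in distribution to `W`. -/
theorem tendstoInDistribution_of_forall_isOpen {ι S T Ω Ω' : Type*}
    [MeasurableSpace Ω] [MeasurableSpace Ω']
    [TopologicalSpace S] [MeasurableSpace S] [OpensMeasurableSpace S] [HasOuterApproxClosed S]
    [TopologicalSpace T] [MeasurableSpace T] [OpensMeasurableSpace T]
    {P : Measure Ω} [IsProbabilityMeasure P] {P' : Measure Ω'} [IsProbabilityMeasure P']
    {l : Filter ι} [l.IsCountablyGenerated]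
    {X : ι → Ω → S} {Z : Ω' → S} {Y : ι → Ω → T} {W : Ω' → T}
    (hX : TendstoInDistribution X l Z (fun _ => P) P')
    (hY : ∀ i, AEMeasurable (Y i) P) (hW : AEMeasurable W P')
    {A : ι → Set Ω} (hA : ∀ i, ∀ᵐ ω ∂P, ω ∈ A i)
    (h : ∀ᵐ ω' ∂P', ∀ G : Set T, IsOpen G → W ω' ∈ G → ∃ U : Set S, IsOpen U ∧ Z ω' ∈ U ∧
      ∀ᶠ i in l, ∀ ω ∈ A i, X i ω ∈ U → Y i ω ∈ G) :
    TendstoInDistribution Y l W (fun _ => P) P' where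
  forall_aemeasurable := hY
  aemeasurable_limit := hW
  tendsto := by
    refine tendsto_of_forall_isOpen_le_liminf' fun G hG => ?_
    obtain ⟨s, hs⟩ := l.exists_antitone_basis
    -- `V k` collects every open set that forces `Y i` into `G` for all `i ∈ s k`. These unions are
    -- open and increase with `k`, so no measurable choice of the neighbourhood `U` is needed, and
    -- the portmanteau inequality for `X` applies to each of them.
    let V : ℕ → Set S := fun k =>
      ⋃₀ {U | IsOpen U ∧ ∀ i ∈ s k, ∀ ω ∈ A i, X i ω ∈ U → Y i ω ∈ G}
    have hVo : ∀ k, IsOpen (V k) := fun k => isOpen_sUnion fun U hU => hU.1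
    have hVm : Monotone V := fun k k' hkk => sUnion_subset_sUnion fun U hU =>
      ⟨hU.1, fun i hi => hU.2 i (hs.antitone hkk hi)⟩
    have h1 : P'.map W G ≤ P'.map Z (⋃ k, V k) := by
      rw [Measure.map_apply_of_aemeasurable hW hG.measurableSet,
        Measure.map_apply_of_aemeasurable hX.aemeasurable_limit
          (isOpen_iUnion hVo).measurableSet]
      refine measure_mono_ae ?_
      filter_upwards [h] with ω' hω' (hWG : W ω' ∈ G)
      obtain ⟨U, hU, hZU, hev⟩ := hω' G hG hWG
      obtain ⟨k, -, hk⟩ := hs.toHasBasis.eventually_iff.1 hev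
      exact mem_iUnion.2 ⟨k, mem_sUnion.2 ⟨U, ⟨hU, fun i hi => hk hi⟩, hZU⟩⟩
    refine h1.trans ?_
    rw [hVm.measure_iUnion]
    refine iSup_le fun k => ?_
    refine (ProbabilityMeasure.le_liminf_measure_open_of_tendsto hX.tendsto (hVo k)).trans ?_
    refine liminf_le_liminf ?_
    filter_upwards [hs.mem k] with i hi
    change P.map (X i) (V k) ≤ P.map (Y i) G
    rw [Measure.map_apply_of_aemeasurable (hY i) hG.measurableSet,
        Measure.map_apply_of_aemeasurable (hX.forall_aemeasurable i) (hVo k).measurableSet]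
    refine measure_mono_ae ?_
    filter_upwards [hA i] with ω hω (hXV : X i ω ∈ V k)
    obtain ⟨U, hU, hXU⟩ := mem_sUnion.1 hXV
    exact hU.2 i hi ω hω hXU

/-! ### Paths in the Skorokhod space -/

namespace SkorokhodSpace

variable {q : ℕ} {a b : Fin q → ℝ}

theorem edist_le_of_forall_abs_sub_le {f g : SkorokhodSpace a b} {c : ℝ}
    (h : ∀ x, |f x - g x| ≤ c) : edist f g ≤ ENNReal.ofReal c := by
  refine iInf_le_of_le (fun p => OrderIso.refl _) ?_
  refine max_le (iSup_le fun x => ?_) (iSup_le fun x => ?_)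
  · rw [edist_dist, Real.dist_eq]
    exact ENNReal.ofReal_le_ofReal (h x)
  · exact (edist_self x).trans_le bot_le

/-- Near a continuous path, closeness in the Skorokhod distance is uniform closeness. -/
theorem exists_forall_abs_sub_le {g : SkorokhodSpace a b} (hg : Continuous g.toFun) {c : ℝ}
    (hc : 0 < c) : ∃ U : Set (SkorokhodSpace a b), IsOpen U ∧ g ∈ U ∧
      ∀ f ∈ U, ∀ x, |f x - g x| ≤ c := by
  have hu : UniformContinuous g.toFun := CompactSpace.uniformContinuous_of_continuous hg
  obtain ⟨d, hd, hd'⟩ := Metric.uniformContinuous_iff.1 hu (c / 2) (by positivity)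
  -- Half of `c` pays for comparing `f ∘ l` with `g`; the other half is the oscillation of `g` under
  -- the displacement by the time change `l`.
  refine ⟨Metric.eball g (ENNReal.ofReal (min d (c / 2))), Metric.isOpen_eball,
    Metric.mem_eball_self (ENNReal.ofReal_pos.2 (lt_min hd (by positivity))), fun f hf x => ?_⟩
  obtain ⟨l, hl⟩ := iInf_lt_iff.1 (Metric.mem_eball.1 hf)
  obtain ⟨y, rfl⟩ : ∃ y, l.app y = x :=
    ⟨TimeChange.app (fun p => (l p).symm) x, funext fun p => (l p).apply_symm_apply (x p)⟩
  have e1 : edist (f (l.app y)) (g y) < ENNReal.ofReal (min d (c / 2)) :=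
    ((le_iSup (fun y => edist (f (l.app y)) (g y)) y).trans (le_max_left _ _)).trans_lt hl
  have e2 : edist (l.app y) y < ENNReal.ofReal (min d (c / 2)) :=
    ((le_iSup (fun y => edist (l.app y) y) y).trans (le_max_right _ _)).trans_lt hl
  rw [edist_dist, ENNReal.ofReal_lt_ofReal_iff (lt_min hd (by positivity))] at e1 e2
  have e3 := hd' (e2.trans_le (min_le_left _ _))
  rw [dist_comm, Real.dist_eq] at e3
  rw [Real.dist_eq] at e1
  have e4 := abs_sub_le (f (l.app y)) (g y) (g (l.app y))
  have e5 := min_le_right d (c / 2)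
  exact e4.trans (by linarith)

/-- The two conditions that define the Skorokhod space. -/
def IsPath (F : RectBox a b → ℝ) : Prop :=
  (∀ (x : RectBox a b) (R : Finset (Fin q)), ∃ L : ℝ, Tendsto F (𝓝[quadrant R x] x) (𝓝 L)) ∧
    ∀ x : RectBox a b, Tendsto F (𝓝[quadrant ∅ x] x) (𝓝 (F x))

theorem isPath_of_continuous {F : RectBox a b → ℝ} (hF : Continuous F) : IsPath F :=
  ⟨fun x _ => ⟨F x, (hF.tendsto x).mono_left inf_le_left⟩,
    fun x => (hF.tendsto x).mono_left inf_le_left⟩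

theorem IsPath.mul {F G : RectBox a b → ℝ} (hF : IsPath F) (hG : IsPath G) :
    IsPath fun x => F x * G x := by
  refine ⟨fun x R => ?_, fun x => (hF.2 x).mul (hG.2 x)⟩
  obtain ⟨L, hL⟩ := hF.1 x R
  obtain ⟨M, hM⟩ := hG.1 x R
  exact ⟨L * M, hL.mul hM⟩

theorem isPath_sum {κ : Type*} (s : Finset κ) {F : κ → RectBox a b → ℝ}
    (hF : ∀ k ∈ s, IsPath (F k)) : IsPath fun x => ∑ k ∈ s, F k x := by
  classical
  refine ⟨fun x R => ?_, fun x => tendsto_finsetSum s fun k hk => (hF k hk).2 x⟩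
  have h : ∀ k, ∃ L, k ∈ s → Tendsto (F k) (𝓝[quadrant R x] x) (𝓝 L) := fun k => by
    by_cases hk : k ∈ s
    · obtain ⟨L, hL⟩ := (hF k hk).1 x R
      exact ⟨L, fun _ => hL⟩
    · exact ⟨0, fun h => absurd h hk⟩
  choose L hL using h
  exact ⟨∑ k ∈ s, L k, tendsto_finsetSum s fun k hk => hL k hk⟩

/-- The only jump is across the hyperplane `x p = c`. Near a point each quadrant lies on one side of
it: for `p ∉ R` the value at `x` persists, for `p ∈ R` the limit is governed by the strict
inequality `c < x p`. -/
theorem isPath_indicator_le (p : Fin q) (c : ℝ) :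
    IsPath fun x : RectBox a b => if c ≤ (x p : ℝ) then (1 : ℝ) else 0 := by
  have hcont : ∀ x : RectBox a b, Tendsto (fun y : RectBox a b => (y p : ℝ)) (𝓝 x) (𝓝 (x p)) :=
    fun x => (continuous_subtype_val.comp (continuous_apply p)).tendsto x
  have hright : ∀ (x : RectBox a b) (R : Finset (Fin q)), p ∉ R →
      Tendsto (fun x : RectBox a b => if c ≤ (x p : ℝ) then (1 : ℝ) else 0)
        (𝓝[quadrant R x] x) (𝓝 (if c ≤ (x p : ℝ) then (1 : ℝ) else 0)) := by
    intro x R hp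
    refine tendsto_const_nhds.congr' ?_
    by_cases hc : c ≤ (x p : ℝ)
    · filter_upwards [self_mem_nhdsWithin] with y hy
      have hy' := hy p
      rw [if_neg hp] at hy'
      have : (x p : ℝ) ≤ y p := hy'
      rw [if_pos hc, if_pos (hc.trans this)]
    · filter_upwards [((hcont x).mono_left inf_le_left).eventually (gt_mem_nhds (not_le.1 hc))]
        with y hy
      rw [if_neg hc, if_neg (not_le.2 hy)]
  refine ⟨fun x R => ?_, fun x => hright x ∅ (Finset.notMem_empty p)⟩
  by_cases hp : p ∈ R
  · refine ⟨if c < (x p : ℝ) then (1 : ℝ) else 0, tendsto_const_nhds.congr' ?_⟩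
    by_cases hc : c < (x p : ℝ)
    · filter_upwards [((hcont x).mono_left inf_le_left).eventually (lt_mem_nhds hc)] with y hy
      rw [if_pos hc, if_pos hy.le]
    · filter_upwards [self_mem_nhdsWithin] with y hy
      have hy' := hy p
      rw [if_pos hp] at hy'
      have : (y p : ℝ) < x p := hy'
      rw [if_neg hc, if_neg (not_le.2 (this.trans_le (not_lt.1 hc)))]
  · exact ⟨_, hright x R hp⟩

/-- The element of the Skorokhod space with a given path. -/
def ofPath (F : RectBox a b → ℝ) (hF : IsPath F) : SkorokhodSpace a b := ⟨F, hF.1, hF.2⟩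

/-- A sequence of paths that converges uniformly converges in the Skorokhod space. -/
theorem tendsto_of_forall_abs_sub_le {ι : Type*} {l : Filter ι} {f : ι → SkorokhodSpace a b}
    {g : SkorokhodSpace a b} (h : ∀ c > 0, ∀ᶠ i in l, ∀ x, |f i x - g x| ≤ c) :
    Tendsto f l (𝓝 g) := by
  rw [EMetric.tendsto_nhds]
  intro c hc
  obtain ⟨r, hr, hrc⟩ := ENNReal.lt_iff_exists_real_btwn.1 hc
  have hr0 : 0 < r := ENNReal.ofReal_pos.1 hrc.1
  filter_upwards [h r hr0] with i hi
  exact (edist_le_of_forall_abs_sub_le hi).trans_lt hrc.2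

end SkorokhodSpace

/-! ### Riemann-Stieltjes integrals against smooth product functions -/

theorem ladderSucc_mem_insert (b : ℝ) (Y : Finset ℝ) (y : ℝ) :
    ladderSucc b Y y = b ∨ ladderSucc b Y y ∈ Y ∧ y < ladderSucc b Y y := by
  have h := Finset.min'_mem (insert b (Y.filter fun z => y < z)) (Finset.insert_nonempty _ _)
  rcases Finset.mem_insert.1 h with h | h
  · exact Or.inl h
  · exact Or.inr (Finset.mem_filter.1 h)

theorem ladderSucc_le_of_mem {b : ℝ} {Y : Finset ℝ} {y z : ℝ} (hz : z ∈ Y) (hyz : y < z) :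
    ladderSucc b Y y ≤ z :=
  Finset.min'_le _ _ (Finset.mem_insert_of_mem (Finset.mem_filter.2 ⟨hz, hyz⟩))

theorem ladderSucc_le (b : ℝ) (Y : Finset ℝ) (y : ℝ) : ladderSucc b Y y ≤ b :=
  Finset.min'_le _ _ (Finset.mem_insert_self _ _)

theorem IsLadder.mem_Icc {a b : ℝ} {Y : Finset ℝ} (hab : a ≤ b) (hY : IsLadder a b Y) {y : ℝ}
    (hy : y ∈ Y) : y ∈ Set.Icc a b := by
  rcases eq_or_ne y a with rfl | h
  · exact ⟨le_rfl, hab⟩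
  · exact Ioo_subset_Icc_self (hY.2 y hy h)

theorem IsLadder.le_ladderSucc {a b : ℝ} {Y : Finset ℝ} (hab : a ≤ b) (hY : IsLadder a b Y)
    {y : ℝ} (hy : y ∈ Y) : y ≤ ladderSucc b Y y := by
  rcases ladderSucc_mem_insert b Y y with h | h
  · rw [h]
    exact (hY.mem_Icc hab hy).2
  · exact h.2.le

/-- The wanted rung is the largest one strictly below `x`. With `eq_of_mem_Ioc_ladderSucc`, the
half-open cells of a ladder partition `(a, b]`. -/
theorem IsLadder.exists_mem_Ioc {a b : ℝ} {Y : Finset ℝ} (hY : IsLadder a b Y) {x : ℝ}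
    (hx : x ∈ Set.Ioc a b) : ∃ y ∈ Y, x ∈ Set.Ioc y (ladderSucc b Y y) := by
  have hne : (Y.filter fun z => z < x).Nonempty := ⟨a, Finset.mem_filter.2 ⟨hY.1, hx.1⟩⟩
  obtain ⟨hm, hmx⟩ := Finset.mem_filter.1 (Finset.max'_mem _ hne)
  refine ⟨_, hm, hmx, ?_⟩
  rcases ladderSucc_mem_insert b Y ((Y.filter fun z => z < x).max' hne) with h | ⟨h, h'⟩
  · exact h.symm ▸ hx.2
  · by_contra hlt
    exact absurd h' (not_lt.2 (Finset.le_max' (Y.filter fun z => z < x) _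
      (Finset.mem_filter.2 ⟨h, not_le.1 hlt⟩)))

theorem eq_of_mem_Ioc_ladderSucc {b : ℝ} {Y : Finset ℝ} {y z x : ℝ} (hy : y ∈ Y) (hz : z ∈ Y)
    (hxy : x ∈ Set.Ioc y (ladderSucc b Y y)) (hxz : x ∈ Set.Ioc z (ladderSucc b Y z)) :
    y = z := by
  rcases lt_trichotomy y z with h | h | h
  · exact absurd hxz.1 (not_lt.2 (hxy.2.trans (ladderSucc_le_of_mem hz h)))
  · exact h
  · exact absurd hxy.1 (not_lt.2 (hxz.2.trans (ladderSucc_le_of_mem hy h)))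

section Pi

variable {ι : Type*} [Fintype ι]

theorem setIntegral_pi_Ioc_prod (a b : ι → ℝ) (G : ι → ℝ → ℝ) :
    ∫ x in Set.univ.pi fun j => Set.Ioc (a j) (b j), ∏ j, G j (x j) =
      ∏ j, ∫ x in Set.Ioc (a j) (b j), G j x := by
  rw [volume_pi, Measure.restrict_pi_pi, integral_fintype_prod_eq_prod]

variable [DecidableEq ι]

theorem altSum_prod (C : ℝ) (g : ι → ℝ → ℝ) (a b : ι → ℝ) :
    altSum (fun x => C * ∏ j, g j (x j)) a b = C * ∏ j, (g j (b j) - g j (a j)) := by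
  rw [Finset.prod_sub, Finset.mul_sum, altSum, Finset.powerset_univ]
  refine Finset.sum_congr rfl fun v _ => ?_
  rw [← Finset.prod_sdiff (Finset.subset_univ v),
    Finset.prod_congr rfl fun j (hj : j ∈ Finset.univ \ v) => by
      rw [Finset.piecewise_eq_of_notMem _ _ _ (Finset.mem_sdiff.1 hj).2],
    Finset.prod_congr rfl fun j (hj : j ∈ v) => by rw [Finset.piecewise_eq_of_mem _ _ _ hj]]
  ring

/-- The Riemann-Stieltjes integral of a continuous function against a product of continuously
differentiable functions of one variable. -/
theorem hasRSIntegral_prod {a b : ι → ℝ} (hab : a ≤ b) {h : (ι → ℝ) → ℝ}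
    (hh : ContinuousOn h (Set.Icc a b)) (C : ℝ) {g g' : ι → ℝ → ℝ}
    (hg : ∀ j x, HasDerivAt (g j) (g' j x) x) (hg' : ∀ j, Continuous (g' j)) :
    HasRSIntegral a b h (fun x => C * ∏ j, g j (x j))
      (∫ x in Set.Icc a b, h x * (C * ∏ j, g' j (x j))) := by
  intro ε hε
  set D : (ι → ℝ) → ℝ := fun x => C * ∏ j, g' j (x j)
  have hD : Continuous D := by
    have := fun j => (hg' j).comp (continuous_apply (A := fun _ : ι => ℝ) j)
    exact continuous_const.mul (continuous_finsetProd _ fun j _ => this j)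
  have hDi : IntegrableOn (fun x => |D x|) (Set.Icc a b) :=
    hD.abs.continuousOn.integrableOn_compact isCompact_Icc
  set K := ∫ x in Set.Icc a b, |D x|
  have hK : 0 ≤ K := integral_nonneg fun x => abs_nonneg _
  -- `K` is the total variation mass of the density `D`; the added `1` keeps the quotient meaningful
  -- for `K = 0` and makes the final bound strict.
  obtain ⟨δ, hδ, hδ'⟩ := Metric.uniformContinuousOn_iff.1
    (isCompact_Icc.uniformContinuousOn_of_continuous hh) (ε / (K + 1)) (by positivity)
  refine ⟨δ, hδ, fun Y tag hY hmesh htag => ?_⟩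
  set s : (ι → ℝ) → (ι → ℝ) := fun y j => ladderSucc (b j) (Y j) (y j)
  set cell : (ι → ℝ) → Set (ι → ℝ) := fun y => Set.univ.pi fun j => Set.Ioc (y j) (s y j)
  have hYm : ∀ {y}, y ∈ Fintype.piFinset Y → ∀ j, y j ∈ Y j := fun hy => Fintype.mem_piFinset.1 hy
  have hcellIcc : ∀ y ∈ Fintype.piFinset Y, Set.Icc y (s y) ⊆ Set.Icc a b := fun y hy =>
    Set.Icc_subset_Icc (fun j => ((hY j).mem_Icc (hab j) (hYm hy j)).1)
      (fun j => ladderSucc_le _ _ _)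
  have hcell : ∀ y, cell y ⊆ Set.Icc y (s y) := fun y x hx =>
    ⟨fun j => (hx j trivial).1.le, fun j => (hx j trivial).2⟩
  have hmeas : ∀ y, MeasurableSet (cell y) := fun y =>
    MeasurableSet.univ_pi fun j => measurableSet_Ioc
  have hdisj : Set.Pairwise (↑(Fintype.piFinset Y)) (Function.onFun Disjoint cell) := by
    intro y hy z hz hne
    refine Set.disjoint_left.2 fun x hx hx' => hne (funext fun j => ?_)
    exact eq_of_mem_Ioc_ladderSucc (hYm hy j) (hYm hz j) (hx j trivial) (hx' j trivial)
  have hunion : ⋃ y ∈ Fintype.piFinset Y, cell y = Set.univ.pi fun j => Set.Ioc (a j) (b j) := by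
    ext x
    simp only [mem_iUnion, exists_prop]
    constructor
    · rintro ⟨y, hy, hx⟩ j -
      exact ⟨((hY j).mem_Icc (hab j) (hYm hy j)).1.trans_lt (hx j trivial).1,
        (hx j trivial).2.trans (ladderSucc_le _ _ _)⟩
    · intro hx
      choose y hy hxy using fun j => (hY j).exists_mem_Ioc (hx j trivial)
      exact ⟨y, Fintype.mem_piFinset.2 hy, fun j _ => hxy j⟩
  -- The half-open cells miss only the lower faces of the closed box, a null set.
  have hsplit : ∀ F : (ι → ℝ) → ℝ, IntegrableOn F (Set.Icc a b) →
      ∫ x in Set.Icc a b, F x = ∑ y ∈ Fintype.piFinset Y, ∫ x in cell y, F x := by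
    intro F hF
    rw [← integral_biUnion_finset _ (fun y _ => hmeas y) hdisj fun y hy =>
      hF.mono_set ((hcell y).trans (hcellIcc y hy)), hunion, volume_pi]
    exact (setIntegral_congr_set Measure.univ_pi_Ioc_ae_eq_Icc).symm
  have hhD : IntegrableOn (fun x => h x * D x) (Set.Icc a b) :=
    (hh.mul hD.continuousOn).integrableOn_compact isCompact_Icc
  -- The fundamental theorem of calculus in each coordinate: the increment of the integrator over a
  -- cell is the integral of its density, so a Riemann-Stieltjes sum differs from the integral only
  -- by the oscillation of `h` on cells.
  have halt : ∀ y ∈ Fintype.piFinset Y,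
      altSum (fun x => C * ∏ j, g j (x j)) y (s y) = ∫ x in cell y, D x := by
    intro y hy
    rw [altSum_prod, integral_const_mul, setIntegral_pi_Ioc_prod]
    congr 1
    refine Finset.prod_congr rfl fun j _ => ?_
    rw [← intervalIntegral.integral_of_le ((hY j).le_ladderSucc (hab j) (hYm hy j)),
      intervalIntegral.integral_eq_sub_of_hasDerivAt (fun x _ => hg j x)
        ((hg' j).intervalIntegrable _ _)]
  rw [hsplit _ hhD, ← Finset.sum_sub_distrib]
  have hterm : ∀ y ∈ Fintype.piFinset Y,
      |h (tag y) * altSum (fun x => C * ∏ j, g j (x j)) y (s y) - ∫ x in cell y, h x * D x| ≤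
        ∫ x in cell y, ε / (K + 1) * |D x| := by
    intro y hy
    have hsub := (hcell y).trans (hcellIcc y hy)
    rw [halt y hy, ← integral_const_mul, ← integral_sub
      ((hD.continuousOn.integrableOn_compact isCompact_Icc).mono_set hsub |>.const_mul _)
      (hhD.mono_set hsub), ← Real.norm_eq_abs]
    refine norm_integral_le_of_norm_le ((hDi.mono_set hsub).const_mul _) ?_
    filter_upwards [ae_restrict_mem (hmeas y)] with x hx
    rw [← sub_mul, Real.norm_eq_abs, abs_mul, ← Real.dist_eq]
    refine mul_le_mul_of_nonneg_right (hδ' _ (hcellIcc y hy (htag y hy)) _ (hsub hx) ?_).le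
      (abs_nonneg _)
    refine (dist_pi_lt_iff hδ).2 fun j => ?_
    have h1 := htag y hy
    have h2 := hcell y hx
    have h3 := hmesh j (y j) (hYm hy j)
    have h4 := h1.1 j
    have h5 := h1.2 j
    have h6 := h2.1 j
    have h7 := h2.2 j
    rw [Real.dist_eq, abs_lt]
    simp only [s] at h7
    constructor <;> linarith
  refine (Finset.abs_sum_le_sum_abs _ _).trans_lt ?_
  refine (Finset.sum_le_sum hterm).trans_lt ?_
  rw [← hsplit _ (hDi.const_mul _), integral_const_mul]
  change ε / (K + 1) * K < ε
  rw [div_mul_eq_mul_div, div_lt_iff₀ (by positivity)]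
  nlinarith

/-- Rescaling of a rectangle with lower corner zero to the unit cube. -/
theorem setIntegral_Icc_zero_eq (F : (ι → ℝ) → ℝ) {b : ι → ℝ} (hb : ∀ j, 0 < b j) :
    ∫ x in Set.Icc 0 b, F x = (∏ j, b j) * ∫ x in Set.Icc (0 : ι → ℝ) 1, F (b * x) := by
  have hdet : Matrix.det (Matrix.diagonal b) = ∏ j, b j := Matrix.det_diagonal
  have hpos : 0 < ∏ j, b j := Finset.prod_pos fun j _ => hb j
  let e : (ι → ℝ) ≃ᵐ (ι → ℝ) :=
    MeasurableEquiv.piCongrRight fun j => (Homeomorph.mulLeft₀ (b j) (hb j).ne').toMeasurableEquiv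
  have he : ∀ x, e x = b * x := fun x => rfl
  have hmap : (Matrix.toLin' (Matrix.diagonal b) : (ι → ℝ) → (ι → ℝ)) = e := by
    funext x j
    rw [he]
    simp [Matrix.mulVec_diagonal]
  have hpre : e ⁻¹' Set.Icc 0 b = Set.Icc 0 1 := by
    ext x
    simp only [mem_preimage, mem_Icc, Pi.le_def, he, Pi.mul_apply, Pi.zero_apply, Pi.one_apply]
    refine and_congr (forall_congr' fun j => mul_nonneg_iff_of_pos_left (hb j))
      (forall_congr' fun j => mul_le_iff_le_one_right (hb j))
  -- Lebesgue measure is `|det|` times its image under the diagonal map.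
  conv_lhs => rw [← Real.smul_map_diagonal_volume_pi (D := b) (by rw [hdet]; exact hpos.ne')]
  rw [Measure.restrict_smul, integral_smul_measure, hmap, e.measurableEmbedding.setIntegral_map,
    hpre, hdet, abs_of_pos hpos, ENNReal.toReal_ofReal hpos.le, smul_eq_mul]
  simp only [he]

end Pi

/-! ### Integration by parts against product functions -/

section ByParts

variable {ι : Type*} [DecidableEq ι]

theorem continuous_glue (v : Finset ι) :
    Continuous fun p : (v → ℝ) × (ι → ℝ) => glue v p.1 p.2 := by
  refine continuous_pi fun j => ?_
  by_cases hj : j ∈ v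
  · simp only [glue, hj, dif_pos]
    exact (continuous_apply (A := fun _ : v => ℝ) _).comp continuous_fst
  · simp only [glue, hj, dif_neg, not_false_iff]
    exact (continuous_apply (A := fun _ : ι => ℝ) _).comp continuous_snd

theorem glue_mem_Icc {v : Finset ι} {x : v → ℝ} {b c : ι → ℝ}
    (hx : x ∈ Set.Icc 0 (fun j : v => b j)) (hc : c ∈ Set.Icc 0 b) :
    glue v x c ∈ Set.Icc 0 b := by
  constructor
  · intro j
    by_cases hj : j ∈ v
    · simp only [glue, hj, dif_pos]
      exact hx.1 ⟨j, hj⟩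
    · simpa only [glue, hj, dif_neg, not_false_iff] using hc.1 j
  · intro j
    by_cases hj : j ∈ v
    · simp only [glue, hj, dif_pos]
      exact hx.2 ⟨j, hj⟩
    · simpa only [glue, hj, dif_neg, not_false_iff] using hc.2 j

variable [Fintype ι]

theorem prod_glue (G : ι → ℝ → ℝ) (v : Finset ι) (x : v → ℝ) (c : ι → ℝ) :
    ∏ j, G j (glue v x c j) = (∏ j ∈ vᶜ, G j (c j)) * ∏ j : v, G j (x j) := by
  rw [← Finset.prod_compl_mul_prod v, ← Finset.prod_coe_sort v]
  congr 1
  · refine Finset.prod_congr rfl fun j hj => ?_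
    simp [glue, Finset.mem_compl.1 hj]
  · refine Finset.prod_congr rfl fun j _ => ?_
    simp [glue]

/-- The integral `∫ h df` in the coordinates `v` over `[0, b_v]`, with the other coordinates fixed
at `b`, for the product function `f = ∏ g j` with derivatives `g' j` of the factors. -/
def byPartsTerm (g g' : ι → ℝ → ℝ) (b : ι → ℝ) (h : (ι → ℝ) → ℝ) (v : Finset ι) : ℝ :=
  ∫ x : v → ℝ in Set.Icc 0 (fun j : v => b j),
    h (glue v x b) * ((∏ j ∈ vᶜ, g j (b j)) * ∏ j : v, g' j (x j))

/-- The integral `∫ f dh` over `[0, b]` for a function `h` that vanishes where a coordinate is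
zero and the product function `f = ∏ g j` with derivatives `g' j` of the factors. -/
def byPartsIntegral (g g' : ι → ℝ → ℝ) (b : ι → ℝ) (h : (ι → ℝ) → ℝ) : ℝ :=
  ∑ v : Finset ι, (-1 : ℝ) ^ v.card * byPartsTerm g g' b h v

/-- A nonempty `w` freezes some coordinate at `0`, where `h` vanishes, so only `w = ∅` contributes
for each `v`. The frozen coordinates turn the product integrand into a constant times a product over
`v`, to which `hasRSIntegral_prod` applies. -/
theorem hasIntegralByParts_byPartsIntegral {b : ι → ℝ} (hb : 0 ≤ b) {h : (ι → ℝ) → ℝ}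
    (hh : ContinuousOn h (Set.Icc 0 b)) (hzero : ∀ z ∈ Set.Icc 0 b, (∃ j, z j = 0) → h z = 0)
    {g g' : ι → ℝ → ℝ} (hg : ∀ j x, HasDerivAt (g j) (g' j x) x)
    (hg' : ∀ j, Continuous (g' j)) :
    HasIntegralByParts 0 b (fun z => ∏ j, g j (z j)) h (byPartsIntegral g g' b h) := by
  refine ⟨fun v w => if w = ∅ then byPartsTerm g g' b h v else 0, fun v w hw => ?_, ?_⟩
  · have hc : w.piecewise (0 : ι → ℝ) b ∈ Set.Icc 0 b := by
      have hbj : ∀ j, 0 ≤ b j := hb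
      refine ⟨fun j => ?_, fun j => ?_⟩ <;> by_cases hj : j ∈ w <;> simp [hj, hbj j]
    have hmaps : Set.MapsTo (fun x : v → ℝ => glue v x (w.piecewise 0 b))
        (Set.Icc 0 (fun j : v => b j)) (Set.Icc 0 b) := fun x hx => glue_mem_Icc hx hc
    have hcont : Continuous fun x : v → ℝ => glue v x (w.piecewise 0 b) :=
      (continuous_glue v).comp (continuous_id.prodMk continuous_const)
    have key := hasRSIntegral_prod (a := 0) (b := fun j : v => b j) (fun j => hb j)
      (hh.comp hcont.continuousOn hmaps) (∏ j ∈ vᶜ, g j (w.piecewise (0 : ι → ℝ) b j))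
      (fun j : v => hg j) (fun j : v => hg' j)
    simp only [prod_glue]
    convert! key using 1
    by_cases hw0 : w = ∅
    · subst hw0
      simp [byPartsTerm]
    · rw [if_neg hw0]
      obtain ⟨i, hi⟩ := Finset.nonempty_iff_ne_empty.2 hw0
      symm
      refine setIntegral_eq_zero_of_forall_eq_zero fun x hx => ?_
      have : h (glue v x (w.piecewise 0 b)) = 0 := by
        refine hzero _ (hmaps hx) ⟨i, ?_⟩
        simp [glue, Finset.mem_compl.1 (hw hi), hi]
      simp [this]
  · refine Finset.sum_congr rfl fun v _ => ?_
    congr 1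
    rw [Finset.sum_eq_single ∅]
    · simp
    · intro w _ hw
      simp [hw]
    · simp

theorem byPartsIntegral_congr {g g' : ι → ℝ → ℝ} {b : ι → ℝ} (hb : 0 ≤ b)
    {h k : (ι → ℝ) → ℝ} (hhk : ∀ z ∈ Set.Icc 0 b, h z = k z) :
    byPartsIntegral g g' b h = byPartsIntegral g g' b k := by
  refine Finset.sum_congr rfl fun v _ => ?_
  congr 1
  refine setIntegral_congr_fun measurableSet_Icc fun x hx => ?_
  simp only [hhk _ (glue_mem_Icc hx ⟨hb, le_rfl⟩)]

theorem byPartsIntegral_const_mul (g g' : ι → ℝ → ℝ) (b : ι → ℝ) (c : ℝ) (h : (ι → ℝ) → ℝ) :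
    byPartsIntegral g g' b (fun z => c * h z) = c * byPartsIntegral g g' b h := by
  simp only [byPartsIntegral, byPartsTerm, mul_assoc, integral_const_mul, Finset.mul_sum]
  refine Finset.sum_congr rfl fun v _ => ?_
  ring

/-- The explicit formula `byPartsIntegral` makes sense for bounded measurable integrators, in
particular for the discontinuous partial sums. -/
theorem integrableOn_byPartsTerm {g g' : ι → ℝ → ℝ} (hg' : ∀ j, Continuous (g' j))
    {b : ι → ℝ} (hb : 0 ≤ b) {h : (ι → ℝ) → ℝ} (hm : Measurable h) {K : ℝ}
    (hK : ∀ z ∈ Set.Icc 0 b, |h z| ≤ K) (v : Finset ι) :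
    IntegrableOn (fun x : v → ℝ => h (glue v x b) * ((∏ j ∈ vᶜ, g j (b j)) * ∏ j : v, g' j (x j)))
      (Set.Icc 0 (fun j : v => b j)) := by
  have hcont : Continuous fun x : v → ℝ => glue v x b :=
    (continuous_glue v).comp (continuous_id.prodMk continuous_const)
  have hprod : Continuous fun x : v → ℝ => (∏ j ∈ vᶜ, g j (b j)) * ∏ j : v, g' j (x j) := by
    have := fun j : v => (hg' j).comp (continuous_apply (A := fun _ : v => ℝ) j)
    exact continuous_const.mul (continuous_finsetProd _ fun j _ => this j)
  refine (hprod.continuousOn.integrableOn_compact isCompact_Icc).bdd_mul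
    (hm.comp hcont.measurable).aestronglyMeasurable (c := K) ?_
  filter_upwards [ae_restrict_mem measurableSet_Icc] with x hx
  exact hK _ (glue_mem_Icc hx ⟨hb, le_rfl⟩)

theorem byPartsIntegral_sum {κ : Type*} (s : Finset κ) {g g' : ι → ℝ → ℝ}
    (hg' : ∀ j, Continuous (g' j)) {b : ι → ℝ} (hb : 0 ≤ b) (a : κ → ℝ) {h : κ → (ι → ℝ) → ℝ}
    (hm : ∀ k, Measurable (h k)) {K : ℝ} (hK : ∀ k, ∀ z ∈ Set.Icc 0 b, |h k z| ≤ K) :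
    byPartsIntegral g g' b (fun z => ∑ k ∈ s, a k * h k z) =
      ∑ k ∈ s, a k * byPartsIntegral g g' b (h k) := by
  simp only [byPartsIntegral, Finset.mul_sum]
  rw [Finset.sum_comm]
  refine Finset.sum_congr rfl fun v _ => ?_
  simp only [byPartsTerm, Finset.sum_mul]
  rw [integral_finsetSum _ fun k _ => ?_, Finset.mul_sum]
  · refine Finset.sum_congr rfl fun k _ => ?_
    simp only [mul_assoc, integral_const_mul]
    ring
  · have := (integrableOn_byPartsTerm (g := g) hg' hb (hm k) (hK k) v).const_mul (a k)
    simpa only [mul_assoc] using this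

/-- Expanding the product of differences over subsets `v` reproduces the sum over `v` in
`byPartsIntegral`, each summand being factored by Fubini. -/
theorem byPartsIntegral_prod (g g' u : ι → ℝ → ℝ) (b : ι → ℝ) :
    byPartsIntegral g g' b (fun z => ∏ j, u j (z j)) =
      ∏ j, (u j (b j) * g j (b j) - ∫ x in Set.Ioc 0 (b j), u j x * g' j x) := by
  rw [Finset.prod_sub, byPartsIntegral, Finset.powerset_univ]
  refine Finset.sum_congr rfl fun v _ => ?_
  rw [mul_assoc]
  congr 1
  simp only [byPartsTerm, prod_glue]
  rw [volume_pi, ← setIntegral_congr_set Measure.univ_pi_Ioc_ae_eq_Icc, ← volume_pi]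
  have h : ∀ x : v → ℝ, (∏ j ∈ vᶜ, u j (b j)) * (∏ j : v, u j (x j)) *
      ((∏ j ∈ vᶜ, g j (b j)) * ∏ j : v, g' j (x j)) =
      (∏ j ∈ vᶜ, u j (b j) * g j (b j)) * ∏ j : v, u j (x j) * g' j (x j) := fun x => by
    rw [Finset.prod_mul_distrib, Finset.prod_mul_distrib]
    ring
  simp only [h, integral_const_mul]
  rw [setIntegral_pi_Ioc_prod (0 : v → ℝ) (fun j : v => b j) (fun j x => u j x * g' j x),
    ← Finset.prod_coe_sort v, Finset.compl_eq_univ_sdiff]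
  rfl

/-! ### Partial sums as integrators, and stability of the integral -/

/-- The partial sum process of an array, in the scaling `n`. -/
def stepSum (a : (ι → ℕ) → ℝ) (n : ι → ℕ) (z : ι → ℝ) : ℝ :=
  ∑ l ∈ Fintype.piFinset fun j => Finset.Icc 1 ⌊(n j : ℝ) * z j⌋₊, a l

/-- The step function factors through the vector of floors, which takes values in a countable
discrete space. -/
theorem measurable_stepSum (a : (ι → ℕ) → ℝ) (n : ι → ℕ) : Measurable (stepSum a n) := by
  have h1 : Measurable fun z : ι → ℝ => fun j => ⌊(n j : ℝ) * z j⌋₊ :=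
    measurable_pi_lambda _ fun j =>
      Nat.measurable_floor.comp (measurable_const.mul (measurable_pi_apply j))
  have h2 : Measurable fun m : ι → ℕ => ∑ l ∈ Fintype.piFinset fun j => Finset.Icc 1 (m j), a l :=
    measurable_of_countable _
  exact h2.comp h1

/-- On a fixed box the summation range becomes independent of `z`, and each summand is a product of
one-dimensional unit jumps at `l j / n j`; this is the form required by `byPartsIntegral_sum` and
`byPartsIntegral_prod`. -/
theorem stepSum_eq_sum_indicator (a : (ι → ℕ) → ℝ) {n : ι → ℕ} (hn : ∀ j, 0 < n j) {b z : ι → ℝ}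
    (hz : z ∈ Set.Icc 0 b) :
    stepSum a n z = ∑ l ∈ Fintype.piFinset fun j => Finset.Icc 1 ⌊(n j : ℝ) * b j⌋₊,
      a l * ∏ j, if (l j : ℝ) / n j ≤ z j then (1 : ℝ) else 0 := by
  have hsub : (Fintype.piFinset fun j => Finset.Icc 1 ⌊(n j : ℝ) * z j⌋₊) ⊆
      Fintype.piFinset fun j => Finset.Icc 1 ⌊(n j : ℝ) * b j⌋₊ :=
    Fintype.piFinset_subset _ _ fun j => Finset.Icc_subset_Icc le_rfl
      (Nat.floor_le_floor (mul_le_mul_of_nonneg_left (hz.2 j) (Nat.cast_nonneg _)))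
  have hiff : ∀ (l : ι → ℕ) (j : ι), (l j : ℝ) / n j ≤ z j ↔ l j ≤ ⌊(n j : ℝ) * z j⌋₊ := by
    intro l j
    have : (0 : ℝ) < n j := Nat.cast_pos.2 (hn j)
    rw [Nat.le_floor_iff (mul_nonneg this.le (hz.1 j)), div_le_iff₀ this, mul_comm]
  rw [stepSum, ← Finset.sum_subset_zero_on_sdiff hsub (fun l hl => ?_) (fun l hl => ?_)]
  · obtain ⟨hl1, hl2⟩ := Finset.mem_sdiff.1 hl
    rw [Fintype.mem_piFinset] at hl1 hl2
    push Not at hl2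
    obtain ⟨j, hj⟩ := hl2
    rw [Finset.prod_eq_zero (Finset.mem_univ j), mul_zero]
    rw [if_neg]
    intro h
    exact hj (Finset.mem_Icc.2 ⟨(Finset.mem_Icc.1 (hl1 j)).1, (hiff l j).1 h⟩)
  · rw [Finset.prod_eq_one, mul_one]
    intro j _
    rw [if_pos ((hiff l j).2 (Finset.mem_Icc.1 (Fintype.mem_piFinset.1 hl j)).2)]

/-- Integrating `g` against a unit jump at `c` evaluates `g` there: `g b - ∫_c^b g' = g c`. The
condition `0 < c` keeps the jump off the lower endpoint, where the integrator has to vanish. -/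
theorem mul_sub_setIntegral_indicator_le {g g' : ℝ → ℝ} (hg : ∀ x, HasDerivAt g (g' x) x)
    (hg' : Continuous g') {c b : ℝ} (hc : 0 < c) (hcb : c ≤ b) :
    (if c ≤ b then (1 : ℝ) else 0) * g b -
      ∫ x in Set.Ioc 0 b, (if c ≤ x then (1 : ℝ) else 0) * g' x = g c := by
  have h1 : ∫ x in Set.Ioc 0 b, (if c ≤ x then (1 : ℝ) else 0) * g' x =
      ∫ x in Set.Icc c b, g' x := by
    have : ∀ x, (if c ≤ x then (1 : ℝ) else 0) * g' x = (Set.Ici c).indicator g' x := fun x => by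
      by_cases h : c ≤ x <;> simp [h]
    simp only [this]
    rw [setIntegral_indicator measurableSet_Ici]
    congr 2
    ext x
    exact ⟨fun h => ⟨h.2, h.1.2⟩, fun h => ⟨⟨hc.trans_le h.1, h.2⟩, h.1⟩⟩
  rw [h1, integral_Icc_eq_integral_Ioc, ← intervalIntegral.integral_of_le hcb,
    intervalIntegral.integral_eq_sub_of_hasDerivAt (fun x _ => hg x)
      (hg'.intervalIntegrable _ _), if_pos hcb]
  ring

/-- Multivariate summation by parts. -/
theorem byPartsIntegral_stepSum {g g' : ι → ℝ → ℝ} (hg : ∀ j x, HasDerivAt (g j) (g' j x) x)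
    (hg' : ∀ j, Continuous (g' j)) {b : ι → ℝ} (hb : 0 ≤ b) (a : (ι → ℕ) → ℝ) {n : ι → ℕ}
    (hn : ∀ j, 0 < n j) :
    byPartsIntegral g g' b (stepSum a n) =
      ∑ l ∈ Fintype.piFinset fun j => Finset.Icc 1 ⌊(n j : ℝ) * b j⌋₊,
        a l * ∏ j, g j ((l j : ℝ) / n j) := by
  rw [byPartsIntegral_congr hb fun z hz => stepSum_eq_sum_indicator a hn hz,
    byPartsIntegral_sum _ hg' hb a (K := 1)]
  · refine Finset.sum_congr rfl fun l hl => ?_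
    rw [byPartsIntegral_prod g g' (fun j x => if (l j : ℝ) / n j ≤ x then (1 : ℝ) else 0) b]
    congr 1
    refine Finset.prod_congr rfl fun j _ => ?_
    obtain ⟨h1, h2⟩ := Finset.mem_Icc.1 (Fintype.mem_piFinset.1 hl j)
    -- Indices start at `1`, so every jump location `l j / n j` is strictly positive.
    have hnj : (0 : ℝ) < n j := Nat.cast_pos.2 (hn j)
    refine mul_sub_setIntegral_indicator_le (hg j) (hg' j)
      (div_pos (Nat.cast_pos.2 h1) hnj) ?_
    rw [Nat.le_floor_iff (mul_nonneg hnj.le (hb j))] at h2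
    rwa [div_le_iff₀ hnj, mul_comm]
  · intro l
    refine Finset.measurable_prod _ fun j _ => Measurable.ite ?_ measurable_const measurable_const
    exact measurableSet_le measurable_const (measurable_pi_apply j)
  · intro l z _
    rw [Finset.abs_prod]
    refine Finset.prod_le_one (fun j _ => abs_nonneg _) fun j _ => ?_
    split_ifs <;> simp

/-- There is one term for each of the `2 ^ card` subsets. Each is linear in the integrator, carries
`card` factors bounded by `M`, and is integrated over a box of volume at most `1`. -/
theorem abs_byPartsIntegral_sub_le {g g' : ι → ℝ → ℝ} (hg' : ∀ j, Continuous (g' j))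
    {b : ι → ℝ} (hb : 0 ≤ b) (hb1 : b ≤ 1) {M : ℝ} (hM0 : 0 ≤ M)
    (hM : ∀ j, ∀ x ∈ Set.Icc (0 : ℝ) 1, |g j x| ≤ M)
    (hM' : ∀ j, ∀ x ∈ Set.Icc (0 : ℝ) 1, |g' j x| ≤ M) {h k : (ι → ℝ) → ℝ}
    (hh : Measurable h) (hk : Measurable k) {K d : ℝ} (hK : ∀ z ∈ Set.Icc 0 b, |k z| ≤ K)
    (hd0 : 0 ≤ d) (hd : ∀ z ∈ Set.Icc 0 b, |h z - k z| ≤ d) :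
    |byPartsIntegral g g' b h - byPartsIntegral g g' b k| ≤
      2 ^ Fintype.card ι * M ^ Fintype.card ι * d := by
  have hKh : ∀ z ∈ Set.Icc 0 b, |h z| ≤ K + d := fun z hz => by
    have h1 := abs_sub_abs_le_abs_sub (h z) (k z)
    have h2 := hd z hz
    have h3 := hK z hz
    linarith
  rw [byPartsIntegral, byPartsIntegral, ← Finset.sum_sub_distrib]
  refine (Finset.abs_sum_le_sum_abs _ _).trans ?_
  have hterm : ∀ v ∈ (Finset.univ : Finset (Finset ι)),
      |(-1 : ℝ) ^ v.card * byPartsTerm g g' b h v - (-1 : ℝ) ^ v.card * byPartsTerm g g' b k v| ≤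
        M ^ Fintype.card ι * d := by
    intro v _
    rw [← mul_sub, abs_mul, abs_pow, abs_neg, abs_one, one_pow, one_mul, byPartsTerm, byPartsTerm,
      ← integral_sub (integrableOn_byPartsTerm hg' hb hh hKh v)
        (integrableOn_byPartsTerm hg' hb hk hK v), ← Real.norm_eq_abs]
    refine (norm_setIntegral_le_of_norm_le_const (C := M ^ Fintype.card ι * d)
      isCompact_Icc.measure_lt_top fun x hx => ?_).trans ?_
    · rw [← sub_mul, norm_mul, mul_comm, Real.norm_eq_abs, Real.norm_eq_abs]
      refine mul_le_mul ?_ (hd _ (glue_mem_Icc hx ⟨hb, le_rfl⟩)) (abs_nonneg _)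
        (pow_nonneg hM0 _)
      have hcard : Fintype.card ι = vᶜ.card + v.card := by
        rw [add_comm, Finset.card_add_card_compl]
      rw [abs_mul, Finset.abs_prod, Finset.abs_prod, hcard, pow_add]
      refine mul_le_mul ((Finset.prod_le_prod (fun j _ => abs_nonneg _)
        fun j _ => hM j _ ⟨hb j, hb1 j⟩).trans_eq (Finset.prod_const M)) ?_
        (Finset.prod_nonneg fun j _ => abs_nonneg _) (pow_nonneg hM0 _)
      rw [← Fintype.card_coe v, ← Finset.card_univ (α := v)]
      exact (Finset.prod_le_prod (fun j _ => abs_nonneg _)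
        fun (j : v) _ => hM' j _ ⟨hx.1 j, (hx.2 j).trans (hb1 j)⟩).trans_eq (Finset.prod_const M)
    · refine mul_le_of_le_one_right (by positivity) ?_
      rw [Measure.real, Real.volume_Icc_pi_toReal (a := (0 : v → ℝ)) fun j => hb j]
      refine Finset.prod_le_one (fun j _ => ?_) fun j _ => ?_
      · simpa using hb j
      · simpa using hb1 j
  refine (Finset.sum_le_card_nsmul _ _ _ hterm).trans (le_of_eq ?_)
  rw [Finset.card_univ, Fintype.card_finset, nsmul_eq_mul]
  push_cast
  ring

/-- The domain of integration depends on the parameter. Rescaling it to the unit cube, possible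
where all `b p j` are positive, moves this dependence into a jointly continuous integrand. -/
theorem continuousOn_byPartsIntegral {X : Type*} [TopologicalSpace X] [FirstCountableTopology X]
    [LocallyCompactSpace X] {g g' : X → ι → ℝ → ℝ} {b : X → ι → ℝ} {h : (ι → ℝ) → ℝ}
    (hg : ∀ j, Continuous fun p : X × ℝ => g p.1 j p.2)
    (hg' : ∀ j, Continuous fun p : X × ℝ => g' p.1 j p.2) (hb : Continuous b)
    (hh : Continuous h) :
    ContinuousOn (fun p => byPartsIntegral (g p) (g' p) (b p) h) {p | ∀ j, 0 < b p j} := by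
  refine continuousOn_finsetSum _ fun v _ => continuousOn_const.mul ?_
  have hbj : ∀ j, Continuous fun p => b p j := fun j => (continuous_pi_iff.1 hb) j
  have key : Continuous fun p => (∏ j : v, b p j) * ∫ x in Set.Icc (0 : v → ℝ) 1,
      h (glue v ((fun j : v => b p j) * x) (b p)) *
        ((∏ j ∈ vᶜ, g p j (b p j)) * ∏ j : v, g' p j (((fun j : v => b p j) * x) j)) := by
    refine Continuous.mul (continuous_finsetProd _ fun j _ => hbj j)
      (continuous_parametric_integral_of_continuous (μ := volume)
        (f := fun p (x : v → ℝ) => h (glue v ((fun j : v => b p j) * x) (b p)) *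
          ((∏ j ∈ vᶜ, g p j (b p j)) * ∏ j : v, g' p j (((fun j : v => b p j) * x) j))) ?_
        isCompact_Icc)
    have hbx : Continuous fun q : X × (v → ℝ) => (fun j : v => b q.1 j) * q.2 :=
      (continuous_pi fun j : v => (hbj j).comp continuous_fst).mul continuous_snd
    refine (hh.comp ((continuous_glue v).comp (hbx.prodMk (hb.comp continuous_fst)))).mul
      ((continuous_finsetProd _ fun j _ => ?_).mul (continuous_finsetProd _ fun j _ => ?_))
    · exact (hg j).comp (continuous_fst.prodMk ((hbj j).comp continuous_fst))
    · exact (hg' j).comp (continuous_fst.prodMk ((continuous_pi_iff.1 hbx) j))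
  refine key.continuousOn.congr fun p hp => ?_
  exact setIntegral_Icc_zero_eq _ fun j : v => hp j

end ByParts

/-! ### The reconstruction kernel -/

/-- A factor of the reconstruction kernel. -/
def kernelFactor (w u : ℝ) : ℝ :=
  if u = 0 then w / Real.pi else Real.sin (w * u) / (Real.pi * u)

theorem kernelFactor_eq_sinc (w u : ℝ) : kernelFactor w u = w / Real.pi * Real.sinc (w * u) := by
  rcases eq_or_ne u 0 with rfl | hu
  · simp [kernelFactor]
  · rcases eq_or_ne w 0 with rfl | hw
    · simp [kernelFactor]
    · rw [kernelFactor, if_neg hu, Real.sinc_of_ne_zero (mul_ne_zero hw hu)]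
      field_simp

/-- Only the origin is at issue; there `sinc` is the divided difference of the sine, hence analytic
with the shifted power series. -/
theorem contDiff_sinc : ContDiff ℝ 1 Real.sinc := by
  refine contDiff_iff_contDiffAt.2 fun x => ?_
  rcases eq_or_ne x 0 with rfl | hx
  · rw [Real.sinc_eq_dslope]
    obtain ⟨p, hp⟩ := Real.analyticAt_sin (x := 0)
    exact AnalyticAt.contDiffAt ⟨_, hp.has_fpower_series_dslope_fslope⟩
  · refine ((Real.contDiff_sin.contDiffAt (x := x)).div contDiffAt_id hx).congr_of_eventuallyEq ?_
    filter_upwards [isOpen_ne.mem_nhds hx] with y hy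
    exact Real.sinc_of_ne_zero hy

theorem contDiff_kernelFactor (w : ℝ) : ContDiff ℝ 1 (kernelFactor w) := by
  have : kernelFactor w = fun u => w / Real.pi * Real.sinc (w * u) :=
    funext (kernelFactor_eq_sinc w)
  rw [this]
  exact contDiff_const.mul (contDiff_sinc.comp (contDiff_const.mul contDiff_id))

theorem continuous_kernelFactor (w : ℝ) : Continuous (kernelFactor w) :=
  (contDiff_kernelFactor w).continuous

theorem reconstructionKernel_eq_prod (Om x : Fin 3 → ℝ) :
    reconstructionKernel Om x = ∏ j, kernelFactor (Om j) (x j) := rfl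

theorem continuous_reconstructionKernel (Om : Fin 3 → ℝ) :
    Continuous (reconstructionKernel Om) := by
  have := fun j => (continuous_kernelFactor (Om j)).comp (continuous_apply (A := fun _ => ℝ) j)
  exact continuous_finsetProd _ fun j _ => this j

theorem abs_reconstructionKernel_le (Om x : Fin 3 → ℝ) :
    |reconstructionKernel Om x| ≤ ∏ j, |Om j / Real.pi| := by
  rw [reconstructionKernel_eq_prod, Finset.abs_prod]
  refine Finset.prod_le_prod (fun j _ => abs_nonneg _) fun j _ => ?_
  rw [kernelFactor_eq_sinc, abs_mul]
  exact mul_le_of_le_one_right (abs_nonneg _) (Real.abs_sinc_le_one _)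

/-- The factors of the integrand `z ↦ φ(t - c₁ z₁, r₂ - c₂ z₂, r₃ - c₃ z₃)`, at the parameter
`p = (c, (s, t, r₂, r₃))`. -/
def shiftedFactor (Om : Fin 3 → ℝ) (p : (Fin 3 → ℝ) × (Fin 4 → ℝ)) (j : Fin 3) (z : ℝ) : ℝ :=
  kernelFactor (Om j) (p.2 j.succ - p.1 j * z)

/-- The derivatives of the factors `shiftedFactor`. -/
def shiftedFactorDeriv (Om : Fin 3 → ℝ) (p : (Fin 3 → ℝ) × (Fin 4 → ℝ)) (j : Fin 3) (z : ℝ) : ℝ :=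
  deriv (kernelFactor (Om j)) (p.2 j.succ - p.1 j * z) * -p.1 j

theorem hasDerivAt_shiftedFactor (Om : Fin 3 → ℝ) (p : (Fin 3 → ℝ) × (Fin 4 → ℝ)) (j : Fin 3)
    (z : ℝ) : HasDerivAt (shiftedFactor Om p j) (shiftedFactorDeriv Om p j z) z := by
  have h1 := ((contDiff_kernelFactor (Om j)).differentiable one_ne_zero
    (p.2 j.succ - p.1 j * z)).hasDerivAt
  have h2 : HasDerivAt (fun z => p.2 j.succ - p.1 j * z) (-p.1 j) z := by
    simpa using ((hasDerivAt_id z).const_mul (p.1 j)).const_sub (p.2 j.succ)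
  exact h1.comp z h2

theorem continuous_shift (j : Fin 3) : Continuous fun q : ((Fin 3 → ℝ) × (Fin 4 → ℝ)) × ℝ =>
    q.1.2 j.succ - q.1.1 j * q.2 := by
  fun_prop

theorem continuous_shiftedFactor (Om : Fin 3 → ℝ) (j : Fin 3) :
    Continuous fun q : ((Fin 3 → ℝ) × (Fin 4 → ℝ)) × ℝ => shiftedFactor Om q.1 j q.2 :=
  (continuous_kernelFactor (Om j)).comp (continuous_shift j)

theorem continuous_shiftedFactorDeriv (Om : Fin 3 → ℝ) (j : Fin 3) :
    Continuous fun q : ((Fin 3 → ℝ) × (Fin 4 → ℝ)) × ℝ => shiftedFactorDeriv Om q.1 j q.2 := by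
  have h1 := ((contDiff_kernelFactor (Om j)).continuous_deriv le_rfl).comp (continuous_shift j)
  exact h1.mul (by fun_prop)

theorem continuous_shiftedFactorDeriv_right (Om : Fin 3 → ℝ) (p : (Fin 3 → ℝ) × (Fin 4 → ℝ))
    (j : Fin 3) : Continuous (shiftedFactorDeriv Om p j) :=
  (continuous_shiftedFactorDeriv Om j).comp (continuous_const.prodMk continuous_id)

/-- The integral `√(c₁ c₂ c₃) ∫_0^s ∫_0^1 ∫_0^1 φ(t - c₁ z₁, r₂ - c₂ z₂, r₃ - c₃ z₃) dh(z)`, at the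
parameter `p = (c, (s, t, r₂, r₃))`. -/
def kernelIntegral (Om : Fin 3 → ℝ) (h : (Fin 3 → ℝ) → ℝ) (p : (Fin 3 → ℝ) × (Fin 4 → ℝ)) : ℝ :=
  Real.sqrt (∏ j, p.1 j) *
    byPartsIntegral (shiftedFactor Om p) (shiftedFactorDeriv Om p) ![p.2 0, 1, 1] h

/-- Joint continuity serves twice: in `c` it allows `n_j τ_j` to be replaced by its limit, and in
`x` it makes the limit paths continuous. -/
theorem continuousOn_kernelIntegral (Om : Fin 3 → ℝ) {h : (Fin 3 → ℝ) → ℝ} (hh : Continuous h) :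
    ContinuousOn (kernelIntegral Om h) {p | 0 < p.2 0} := by
  have hb : Continuous fun p : (Fin 3 → ℝ) × (Fin 4 → ℝ) => ![p.2 0, 1, 1] := by
    refine continuous_pi fun j => ?_
    fin_cases j
    · exact (continuous_apply (A := fun _ : Fin 4 => ℝ) 0).comp
        (continuous_snd (X := Fin 3 → ℝ))
    · exact continuous_const
    · exact continuous_const
  refine ContinuousOn.mul (by fun_prop) ((continuousOn_byPartsIntegral
    (continuous_shiftedFactor Om) (continuous_shiftedFactorDeriv Om) hb hh).mono fun p hp j => ?_)
  fin_cases j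
  · exact hp
  · exact one_pos
  · exact one_pos

/-! ### The centered detector as an integral by parts -/

theorem sum_grid (m : Fin 3 → ℕ) (F : (Fin 3 → ℕ) → ℝ) :
    ∑ l ∈ grid m, F l = ∑ l₀ ∈ Finset.Icc 1 (m 0), ∑ l₁ ∈ Finset.Icc 1 (m 1),
      ∑ l₂ ∈ Finset.Icc 1 (m 2), F ![l₀, l₁, l₂] := by
  simp only [← Finset.sum_product']
  refine Finset.sum_nbij' (fun l => (l 0, l 1, l 2)) (fun q => ![q.1, q.2.1, q.2.2]) ?_ ?_ ?_ ?_ ?_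
  · intro l hl
    have := Fintype.mem_piFinset.1 hl
    simp only [Finset.mem_product]
    exact ⟨this 0, this 1, this 2⟩
  · intro q hq
    simp only [Finset.mem_product] at hq
    refine Fintype.mem_piFinset.2 fun j => ?_
    fin_cases j
    · exact hq.1
    · exact hq.2.1
    · exact hq.2.2
  · intro l _
    funext j
    fin_cases j <;> rfl
  · intro q _
    rfl
  · intro l _
    congr 1
    funext j
    fin_cases j <;> rfl

/-- The centered observations. -/
def centeredArray (s₀ : ℝ) (n : Fin 3 → ℕ) (y : (Fin 3 → ℕ) → ℝ) (l : Fin 3 → ℕ) : ℝ :=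
  y l - learningAverage s₀ n y l

/-- The discrete counterpart of `bridgedSheet`: the learning average is constant in the first index,
so summing it over that index only multiplies it by `⌊n₁z₁⌋`. With an empty learning sample both
correction terms are `0`, by division by zero. -/
theorem stepSum_centeredArray (s₀ : ℝ) (n : Fin 3 → ℕ) (y : (Fin 3 → ℕ) → ℝ) (z : Fin 3 → ℝ) :
    stepSum (centeredArray s₀ n y) n z = stepSum y n z -
      (⌊(n 0 : ℝ) * z 0⌋₊ : ℝ) / (⌊(n 0 : ℝ) * s₀⌋₊ : ℝ) *
        stepSum y n (Function.update z 0 s₀) := by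
  have hs : ∀ (a : (Fin 3 → ℕ) → ℝ) (z : Fin 3 → ℝ), stepSum a n z =
      ∑ l ∈ grid fun j => ⌊(n j : ℝ) * z j⌋₊, a l := fun a z => rfl
  simp only [hs, centeredArray, Finset.sum_sub_distrib]
  congr 1
  have hu : ∀ l₀ l₁ l₂ k : ℕ, Function.update ![l₀, l₁, l₂] 0 k = ![k, l₁, l₂] := fun _ _ _ _ => by
    funext j
    fin_cases j <;> rfl
  have h1 : Function.update z 0 s₀ 1 = z 1 := rfl
  have h2 : Function.update z 0 s₀ 2 = z 2 := rfl
  simp only [sum_grid, learningAverage, hu, Function.update_self, Finset.sum_const, h1, h2,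
    Nat.card_Icc, Nat.add_sub_cancel, nsmul_eq_mul, ← Finset.mul_sum]
  have hcomm : ∑ k ∈ Finset.Icc 1 ⌊(n 0 : ℝ) * s₀⌋₊, ∑ l₁ ∈ Finset.Icc 1 ⌊(n 1 : ℝ) * z 1⌋₊,
      ∑ l₂ ∈ Finset.Icc 1 ⌊(n 2 : ℝ) * z 2⌋₊, y ![k, l₁, l₂] =
      ∑ l₁ ∈ Finset.Icc 1 ⌊(n 1 : ℝ) * z 1⌋₊, ∑ l₂ ∈ Finset.Icc 1 ⌊(n 2 : ℝ) * z 2⌋₊,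
        ∑ k ∈ Finset.Icc 1 ⌊(n 0 : ℝ) * s₀⌋₊, y ![k, l₁, l₂] := by
    rw [Finset.sum_comm]
    exact Finset.sum_congr rfl fun l₁ _ => Finset.sum_comm
  rw [hcomm, div_eq_mul_inv, mul_assoc, mul_left_comm]

theorem centeredDetector_eq_sum (Om : Fin 3 → ℝ) (s₀ : ℝ) (τ : Fin 3 → ℕ → ℝ) (n : Fin 3 → ℕ)
    (y : (Fin 3 → ℕ) → ℝ) (x : Fin 4 → ℝ) :
    centeredDetector Om s₀ τ n y x = Real.sqrt (∏ j, τ j (n j)) *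
      ∑ l ∈ grid ![⌊(n 0 : ℝ) * x 0⌋₊, n 1, n 2], centeredArray s₀ n y l *
        reconstructionKernel Om (fun j => x j.succ - samplingPoint τ n l j) := rfl

/-- A sampling point is the jump location `l j / n j` scaled by `n j * τ j (n j)`, and the
normalization splits as `√∏τ = √∏(nτ) · (√∏n)⁻¹`. The detector and its limit thereby become values
of one functional. -/
theorem centeredDetector_eq_byPartsIntegral (Om : Fin 3 → ℝ) (s₀ : ℝ) (τ : Fin 3 → ℕ → ℝ)
    {n : Fin 3 → ℕ} (hn : ∀ j, 0 < n j) (y : (Fin 3 → ℕ) → ℝ) {x : Fin 4 → ℝ} (hx : 0 ≤ x 0) :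
    centeredDetector Om s₀ τ n y x = kernelIntegral Om
      (fun z => (Real.sqrt (∏ j, (n j : ℝ)))⁻¹ * stepSum (centeredArray s₀ n y) n z)
      (fun j => (n j : ℝ) * τ j (n j), x) := by
  have hn' : ∀ j, (0 : ℝ) < n j := fun j => Nat.cast_pos.2 (hn j)
  have hb : (0 : Fin 3 → ℝ) ≤ ![x 0, 1, 1] := by
    intro j
    fin_cases j
    · exact hx
    · exact zero_le_one
    · exact zero_le_one
  have hgrid : (Fintype.piFinset fun j => Finset.Icc 1 ⌊(n j : ℝ) * ![x 0, 1, 1] j⌋₊) =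
      grid ![⌊(n 0 : ℝ) * x 0⌋₊, n 1, n 2] := by
    rw [grid]
    congr 1
    funext j
    fin_cases j <;> simp
  have hN : 0 < ∏ j, (n j : ℝ) := Finset.prod_pos fun j _ => hn' j
  have hsqrt : Real.sqrt (∏ j, τ j (n j)) =
      Real.sqrt (∏ j, (n j : ℝ) * τ j (n j)) * (Real.sqrt (∏ j, (n j : ℝ)))⁻¹ := by
    rw [Finset.prod_mul_distrib, Real.sqrt_mul hN.le, mul_comm (Real.sqrt _), mul_assoc,
      mul_inv_cancel₀ (Real.sqrt_pos.2 hN).ne', mul_one]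
  rw [kernelIntegral, byPartsIntegral_const_mul, byPartsIntegral_stepSum
    (hasDerivAt_shiftedFactor Om _) (continuous_shiftedFactorDeriv_right Om _) hb _ hn, hgrid,
    centeredDetector_eq_sum, hsqrt, mul_assoc]
  congr 2
  refine Finset.sum_congr rfl fun l _ => ?_
  congr 1
  refine Finset.prod_congr rfl fun j _ => ?_
  have : (n j : ℝ) * τ j (n j) * ((l j : ℝ) / n j) = samplingPoint τ n l j := by
    rw [samplingPoint]
    have := (hn' j).ne'
    field_simp
  simp only [shiftedFactor, this]
  rfl

/-! ### Uniform approximation of the detector -/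

/-- Clamping each coordinate to `[0, 1]` extends the path, so that the continuity results for
globally continuous integrators apply. -/
theorem exists_continuous_eqOn_Icc {ι : Type*} {h : (ι → ℝ) → ℝ}
    (hh : ContinuousOn h (Set.Icc 0 1)) :
    ∃ k : (ι → ℝ) → ℝ, Continuous k ∧ ∀ z ∈ Set.Icc (0 : ι → ℝ) 1, k z = h z := by
  have hc : Continuous fun (z : ι → ℝ) j => max 0 (min (z j) 1) := by fun_prop
  refine ⟨fun z => h fun j => max 0 (min (z j) 1), hh.comp_continuous hc fun z => ?_,
    fun z hz => ?_⟩
  · exact ⟨fun j => le_max_left _ _, fun j => max_le zero_le_one (min_le_right _ _)⟩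
  · refine congrArg h (funext fun j => ?_)
    have hj : 0 ≤ z j ∧ z j ≤ 1 := ⟨hz.1 j, hz.2 j⟩
    rw [min_eq_left hj.2, max_eq_right hj.1]

theorem continuous_bridgedSheet (s₀ : ℝ) {h : (Fin 3 → ℝ) → ℝ} (hh : Continuous h) :
    Continuous (bridgedSheet s₀ h) := by
  refine hh.sub (Continuous.mul (by fun_prop) (hh.comp ?_))
  exact continuous_id.update 0 continuous_const

theorem update_mem_Icc {s₀ : ℝ} (hs₀ : s₀ ∈ Set.Icc (0 : ℝ) 1) {z : Fin 3 → ℝ}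
    (hz : z ∈ Set.Icc (0 : Fin 3 → ℝ) 1) :
    Function.update z 0 s₀ ∈ Set.Icc (0 : Fin 3 → ℝ) 1 := by
  refine ⟨fun j => ?_, fun j => ?_⟩ <;> rcases eq_or_ne j 0 with rfl | hj
  · simpa using hs₀.1
  · simpa [hj] using hz.1 j
  · simpa using hs₀.2
  · simpa [hj] using hz.2 j

theorem bridgedSheet_congr {s₀ : ℝ} (hs₀ : s₀ ∈ Set.Icc (0 : ℝ) 1) {h k : (Fin 3 → ℝ) → ℝ}
    (hhk : ∀ z ∈ Set.Icc (0 : Fin 3 → ℝ) 1, h z = k z) :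
    ∀ z ∈ Set.Icc (0 : Fin 3 → ℝ) 1, bridgedSheet s₀ h z = bridgedSheet s₀ k z := fun z hz => by
  rw [bridgedSheet, bridgedSheet, hhk z hz, hhk _ (update_mem_Icc hs₀ hz)]

theorem eventually_abs_floor_div_floor_sub_le {s₀ : ℝ} (hs₀ : 0 < s₀) (hs₁ : s₀ ≤ 1) {ρ : ℝ}
    (hρ : 0 < ρ) : ∀ᶠ m : ℕ in atTop, 0 < ⌊(m : ℝ) * s₀⌋₊ ∧ ∀ z ∈ Set.Icc (0 : ℝ) 1,
      |(⌊(m : ℝ) * z⌋₊ : ℝ) / (⌊(m : ℝ) * s₀⌋₊ : ℝ) - z / s₀| ≤ ρ := by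
  -- `m s₀ - 1` bounds `⌊m s₀⌋` from below; once it exceeds `2 / (s₀ ρ)`, the denominator `⌊m s₀⌋
  -- s₀` absorbs a numerator of size `2`, uniformly in `z`.
  have hlim : Tendsto (fun m : ℕ => (m : ℝ) * s₀ - 1) atTop atTop :=
    tendsto_atTop_add_const_right _ _ (tendsto_natCast_atTop_atTop.atTop_mul_const hs₀)
  filter_upwards [hlim.eventually_ge_atTop (2 / (s₀ * ρ)), hlim.eventually_gt_atTop 0]
    with m hm hm0
  have hK1 := Nat.lt_floor_add_one ((m : ℝ) * s₀)
  have hK2 := Nat.floor_le (mul_nonneg (Nat.cast_nonneg m) hs₀.le)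
  have hK0 : (0 : ℝ) < (⌊(m : ℝ) * s₀⌋₊ : ℝ) := by linarith
  refine ⟨by exact_mod_cast hK0, fun z hz => ?_⟩
  have hA1 := Nat.lt_floor_add_one ((m : ℝ) * z)
  have hA2 := Nat.floor_le (mul_nonneg (Nat.cast_nonneg m) hz.1)
  have hKρ : 2 ≤ ρ * ((⌊(m : ℝ) * s₀⌋₊ : ℝ) * s₀) := by
    rw [div_le_iff₀ (by positivity)] at hm
    have : ((m : ℝ) * s₀ - 1) * (s₀ * ρ) ≤ (⌊(m : ℝ) * s₀⌋₊ : ℝ) * (s₀ * ρ) :=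
      mul_le_mul_of_nonneg_right (by linarith) (by positivity)
    linarith
  set A : ℝ := (⌊(m : ℝ) * z⌋₊ : ℝ)
  set K : ℝ := (⌊(m : ℝ) * s₀⌋₊ : ℝ)
  rw [div_sub_div _ _ hK0.ne' hs₀.ne', abs_div, abs_of_pos (mul_pos hK0 hs₀),
    div_le_iff₀ (mul_pos hK0 hs₀)]
  refine le_trans ?_ hKρ
  -- The numerator depends only on the two rounding errors, each contributing a number in `[0, 1]`.
  have e : A * s₀ - K * z = z * (m * s₀ - K) - s₀ * (m * z - A) := by ring
  have b1 : z * (m * s₀ - K) ≤ 1 := mul_le_one₀ hz.2 (by linarith) (by linarith)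
  have b2 : s₀ * (m * z - A) ≤ 1 := mul_le_one₀ hs₁ (by linarith) (by linarith)
  have b3 : 0 ≤ z * (m * s₀ - K) := mul_nonneg hz.1 (by linarith)
  have b4 : 0 ≤ s₀ * (m * z - A) := mul_nonneg hs₀.le (by linarith)
  rw [e, abs_le]
  constructor <;> linarith

theorem tendsto_apply_atTop {ι : Type*} (j : ι) :
    Tendsto (fun n : ι → ℕ => n j) atTop atTop :=
  tendsto_atTop.2 fun k => (eventually_ge_atTop fun _ => k).mono fun _ hn => hn j

/-- The centered partial sum process is close to the bridged path when the partial sum process is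
close to the path. -/
theorem exists_abs_stepSum_centeredArray_sub_le {s₀ : ℝ} (hs₀ : s₀ ∈ Set.Ioo (0 : ℝ) 1)
    {h : (Fin 3 → ℝ) → ℝ} (hh : ContinuousOn h (Set.Icc 0 1)) {d : ℝ} (hd : 0 < d) :
    ∃ δ > 0, ∀ᶠ n : Fin 3 → ℕ in atTop, ∀ (c : ℝ) (y : (Fin 3 → ℕ) → ℝ),
      (∀ z ∈ Set.Icc (0 : Fin 3 → ℝ) 1, |c * stepSum y n z - h z| ≤ δ) →
      ∀ z ∈ Set.Icc (0 : Fin 3 → ℝ) 1,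
        |c * stepSum (centeredArray s₀ n y) n z - bridgedSheet s₀ h z| ≤ d := by
  obtain ⟨M, hM⟩ := isCompact_Icc.exists_bound_of_continuousOn hh
  have hM0 : 0 ≤ M := (norm_nonneg _).trans (hM 0 ⟨le_rfl, zero_le_one⟩)
  have hs : s₀ ∈ Set.Icc (0 : ℝ) 1 := ⟨hs₀.1.le, hs₀.2.le⟩
  have hinv : 0 < 1 / s₀ := one_div_pos.2 hs₀.1
  have hρ : 0 < min 1 (d / (2 * (M + 1))) := lt_min one_pos (by positivity)
  -- The errors of the two partial sums add up to `(1 + |r|) δ` with `|r| ≤ 1 + 1 / s₀`, hence to at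
  -- most `d / 2`. The other half covers the error of the ratio `r` times the bound `M` of the path.
  refine ⟨d / (2 * (2 + 1 / s₀)), by positivity, ?_⟩
  filter_upwards [(tendsto_apply_atTop (0 : Fin 3)).eventually
    (eventually_abs_floor_div_floor_sub_le hs₀.1 hs₀.2.le hρ)] with n hn c y hy z hz
  have hz0 : z 0 ∈ Set.Icc (0 : ℝ) 1 := ⟨hz.1 0, hz.2 0⟩
  have hr := hn.2 (z 0) hz0
  rw [stepSum_centeredArray, bridgedSheet]
  set r : ℝ := (⌊(n 0 : ℝ) * z 0⌋₊ : ℝ) / (⌊(n 0 : ℝ) * s₀⌋₊ : ℝ)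
  have h1 := hy z hz
  have h2 := hy _ (update_mem_Icc hs hz)
  have h3 := hM _ (update_mem_Icc hs hz)
  rw [Real.norm_eq_abs] at h3
  set u := Function.update z 0 s₀
  have hr1 : |r| ≤ 1 + 1 / s₀ := by
    have h4 : z 0 / s₀ ≤ 1 / s₀ := div_le_div_of_nonneg_right hz0.2 hs₀.1.le
    have h5 : 0 ≤ z 0 / s₀ := div_nonneg hz0.1 hs₀.1.le
    have h6 := hr.trans (min_le_left _ _)
    rw [abs_le] at h6 ⊢
    constructor <;> linarith
  have e : c * (stepSum y n z - r * stepSum y n u) - (h z - z 0 / s₀ * h u) =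
      (c * stepSum y n z - h z) - r * (c * stepSum y n u - h u) - (r - z 0 / s₀) * h u := by ring
  rw [e]
  have b1 : |r * (c * stepSum y n u - h u)| ≤ (1 + 1 / s₀) * (d / (2 * (2 + 1 / s₀))) := by
    rw [abs_mul]
    exact mul_le_mul hr1 h2 (abs_nonneg _) (by positivity)
  have b2 : |(r - z 0 / s₀) * h u| ≤ d / (2 * (M + 1)) * M := by
    rw [abs_mul]
    exact mul_le_mul (hr.trans (min_le_right _ _)) h3 (abs_nonneg _) (by positivity)
  have b3 : d / (2 * (M + 1)) * M ≤ d / 2 := by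
    rw [div_mul_eq_mul_div, div_le_div_iff₀ (by positivity) two_pos]
    nlinarith
  have b4 : d / (2 * (2 + 1 / s₀)) + (1 + 1 / s₀) * (d / (2 * (2 + 1 / s₀))) = d / 2 := by
    field_simp
    ring
  have t1 := abs_sub ((c * stepSum y n z - h z) - r * (c * stepSum y n u - h u))
    ((r - z 0 / s₀) * h u)
  have t2 := abs_sub (c * stepSum y n z - h z) (r * (c * stepSum y n u - h u))
  linarith

theorem kernelIntegral_congr (Om : Fin 3 → ℝ) {h k : (Fin 3 → ℝ) → ℝ}
    {p : (Fin 3 → ℝ) × (Fin 4 → ℝ)} (hp : p.2 0 ∈ Set.Icc (0 : ℝ) 1)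
    (hhk : ∀ z ∈ Set.Icc (0 : Fin 3 → ℝ) 1, h z = k z) :
    kernelIntegral Om h p = kernelIntegral Om k p := by
  have hb1 : ![p.2 0, 1, 1] ≤ (1 : Fin 3 → ℝ) := by
    intro j
    fin_cases j
    exacts [hp.2, le_rfl, le_rfl]
  have hb : (0 : Fin 3 → ℝ) ≤ ![p.2 0, 1, 1] := by
    intro j
    fin_cases j
    exacts [hp.1, zero_le_one, zero_le_one]
  rw [kernelIntegral, kernelIntegral,
    byPartsIntegral_congr hb fun z hz => hhk z ⟨hz.1, hz.2.trans hb1⟩]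

/-- The Lipschitz continuity of the integral in the integrator, locally uniformly in the
parameters. -/
theorem exists_abs_kernelIntegral_sub_le (Om : Fin 3 → ℝ) {S : Set ((Fin 3 → ℝ) × (Fin 4 → ℝ))}
    (hS : IsCompact S) (hS01 : ∀ p ∈ S, p.2 0 ∈ Set.Icc (0 : ℝ) 1) {k : (Fin 3 → ℝ) → ℝ}
    (hk : Continuous k) :
    ∃ L > 0, ∀ p ∈ S, ∀ (h : (Fin 3 → ℝ) → ℝ) (d : ℝ), Measurable h → 0 ≤ d →
      (∀ z ∈ Set.Icc (0 : Fin 3 → ℝ) 1, |h z - k z| ≤ d) →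
      |kernelIntegral Om h p - kernelIntegral Om k p| ≤ L * d := by
  obtain ⟨K, hK⟩ := (isCompact_Icc (a := (0 : Fin 3 → ℝ)) (b := 1)).exists_bound_of_continuousOn
    hk.continuousOn
  have hS' := hS.prod (isCompact_Icc (a := (0 : ℝ)) (b := 1))
  choose M hM using fun j => hS'.exists_bound_of_continuousOn
    (continuous_shiftedFactor Om j).continuousOn
  choose M' hM' using fun j => hS'.exists_bound_of_continuousOn
    (continuous_shiftedFactorDeriv Om j).continuousOn
  obtain ⟨Q, hQ⟩ := hS.exists_bound_of_continuousOn (f := fun p => Real.sqrt (∏ j, p.1 j))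
    (by fun_prop)
  set N := ∑ j, (|M j| + |M' j|)
  have hN0 : 0 ≤ N := Finset.sum_nonneg fun j _ => by positivity
  have hN : ∀ j, |M j| + |M' j| ≤ N := fun j =>
    Finset.single_le_sum (f := fun j => |M j| + |M' j|) (fun j _ => by positivity)
      (Finset.mem_univ j)
  -- `Q` bounds the square root and `N` all factors and derivatives on the compact parameter set;
  -- the added `1` only makes the constant positive.
  refine ⟨|Q| * (2 ^ 3 * N ^ 3) + 1, by positivity, fun p hp h d hh hd hhd => ?_⟩
  have hp0 := hS01 p hp
  have hb1 : ![p.2 0, 1, 1] ≤ (1 : Fin 3 → ℝ) := by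
    intro j
    fin_cases j
    exacts [hp0.2, le_rfl, le_rfl]
  have hb : (0 : Fin 3 → ℝ) ≤ ![p.2 0, 1, 1] := by
    intro j
    fin_cases j
    exacts [hp0.1, zero_le_one, zero_le_one]
  have key := abs_byPartsIntegral_sub_le (g := shiftedFactor Om p)
    (continuous_shiftedFactorDeriv_right Om p) hb hb1 hN0
    (fun j x hx => (hM j (p, x) ⟨hp, hx⟩).trans
      ((le_abs_self _).trans ((le_add_of_nonneg_right (abs_nonneg _)).trans (hN j))))
    (fun j x hx => (hM' j (p, x) ⟨hp, hx⟩).trans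
      ((le_abs_self _).trans ((le_add_of_nonneg_left (abs_nonneg _)).trans (hN j))))
    hh hk.measurable (fun z hz => hK z ⟨hz.1, hz.2.trans hb1⟩) hd
    fun z hz => hhd z ⟨hz.1, hz.2.trans hb1⟩
  rw [Fintype.card_fin] at key
  rw [kernelIntegral, kernelIntegral, ← mul_sub, abs_mul]
  have hQp : |Real.sqrt (∏ j, p.1 j)| ≤ |Q| := (hQ p hp).trans (le_abs_self _)
  calc _ ≤ |Q| * (2 ^ 3 * N ^ 3 * d) := mul_le_mul hQp key (abs_nonneg _) (abs_nonneg _)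
    _ ≤ _ := by linarith

/-- If the normalized partial sums of the array `y` are uniformly close to a continuous path `h`,
then the detector that is computed from `y` is uniformly close to the integral of the kernel
against the bridged path. -/
theorem exists_abs_centeredDetector_sub_le (Om : Fin 3 → ℝ) {s₀ : ℝ} (hs₀ : s₀ ∈ Set.Ioo (0 : ℝ) 1)
    {τ : Fin 3 → ℕ → ℝ} {τbar : Fin 3 → ℝ}
    (hτlim : ∀ j, Tendsto (fun m : ℕ => (m : ℝ) * τ j m) atTop (𝓝 (τbar j)))
    {h : (Fin 3 → ℝ) → ℝ} (hh : ContinuousOn h (Set.Icc 0 1)) {η : ℝ} (hη : 0 < η) :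
    ∃ δ > 0, ∀ᶠ n : Fin 3 → ℕ in atTop, ∀ y : (Fin 3 → ℕ) → ℝ,
      (∀ z ∈ Set.Icc (0 : Fin 3 → ℝ) 1,
        |(Real.sqrt (∏ j, (n j : ℝ)))⁻¹ * stepSum y n z - h z| ≤ δ) →
      ∀ x ∈ Set.Icc ![s₀, 0, 0, 0] ![1, τbar 0, τbar 1, τbar 2],
        |centeredDetector Om s₀ τ n y x - kernelIntegral Om (bridgedSheet s₀ h) (τbar, x)| ≤ η := by
  obtain ⟨k, hk, hkh⟩ := exists_continuous_eqOn_Icc hh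
  have hs : s₀ ∈ Set.Icc (0 : ℝ) 1 := ⟨hs₀.1.le, hs₀.2.le⟩
  have hbk := continuous_bridgedSheet s₀ hk
  set X : Set (Fin 4 → ℝ) := Set.Icc ![s₀, 0, 0, 0] ![1, τbar 0, τbar 1, τbar 2]
  -- A compact neighbourhood of the limiting parameters that eventually contains `n_j τ_j`; on it
  -- the Lipschitz constant and the modulus of continuity are uniform. Each of the two errors
  -- receives `η / 2`.
  set S : Set ((Fin 3 → ℝ) × (Fin 4 → ℝ)) := Metric.closedBall τbar 1 ×ˢ X
  have hS : IsCompact S := (isCompact_closedBall _ _).prod isCompact_Icc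
  have hX : ∀ x ∈ X, s₀ ≤ x 0 ∧ x 0 ≤ 1 := fun x hx => ⟨hx.1 0, hx.2 0⟩
  obtain ⟨L, hL, hLip⟩ := exists_abs_kernelIntegral_sub_le Om hS
    (fun p hp => ⟨hs.1.trans (hX p.2 hp.2).1, (hX p.2 hp.2).2⟩) hbk
  have huc := Metric.uniformContinuousOn_iff.1 (hS.uniformContinuousOn_of_continuous
    ((continuousOn_kernelIntegral Om hbk).mono fun p hp =>
      hs₀.1.trans_le (hX p.2 hp.2).1)) (η / 2) (by positivity)
  obtain ⟨r, hr, hr'⟩ := huc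
  obtain ⟨δ, hδ, hδ'⟩ := exists_abs_stepSum_centeredArray_sub_le hs₀ hk.continuousOn
    (d := η / (2 * L)) (by positivity)
  have hc : Tendsto (fun n : Fin 3 → ℕ => fun j => (n j : ℝ) * τ j (n j)) atTop (𝓝 τbar) :=
    tendsto_pi_nhds.2 fun j => (hτlim j).comp (tendsto_apply_atTop j)
  refine ⟨δ, hδ, ?_⟩
  filter_upwards [hδ', hc.eventually (Metric.ball_mem_nhds τbar (lt_min hr one_pos)),
    eventually_ge_atTop 1] with n hn hcn hn1 y hy x hx
  have hnpos : ∀ j, 0 < n j := fun j => hn1 j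
  have hx0 : x 0 ∈ Set.Icc (0 : ℝ) 1 := ⟨hs.1.trans (hX x hx).1, (hX x hx).2⟩
  set c : Fin 3 → ℝ := fun j => (n j : ℝ) * τ j (n j)
  have hcS : (c, x) ∈ S := ⟨(hcn.trans_le (min_le_right _ _)).le, hx⟩
  have hτS : (τbar, x) ∈ S := ⟨Metric.mem_closedBall_self zero_le_one, hx⟩
  rw [centeredDetector_eq_byPartsIntegral Om s₀ τ hnpos y hx0.1,
    kernelIntegral_congr Om (p := (τbar, x)) hx0
      (bridgedSheet_congr hs fun z hz => (hkh z hz).symm)]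
  have e1 := hLip (c, x) hcS
    (fun z => (Real.sqrt (∏ j, (n j : ℝ)))⁻¹ * stepSum (centeredArray s₀ n y) n z) (η / (2 * L))
    (measurable_const.mul (measurable_stepSum _ _)) (by positivity)
    (hn _ y fun z hz => by rw [hkh z hz]; exact hy z hz)
  have e2 : |kernelIntegral Om (bridgedSheet s₀ k) (c, x) -
      kernelIntegral Om (bridgedSheet s₀ k) (τbar, x)| < η / 2 := by
    refine hr' _ hcS _ hτS ?_
    rw [Prod.dist_eq, dist_self]
    exact max_lt (hcn.trans_le (min_le_left _ _)) hr
  have e3 : L * (η / (2 * L)) = η / 2 := by field_simp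
  refine (abs_sub_le _ (kernelIntegral Om (bridgedSheet s₀ k) (c, x)) _).trans ?_
  linarith

/-! ### The detector as a random element of the Skorokhod space -/

/-- The argument `s` enters only through the summation range. Expressed by indicators, the detector
is a finite sum of right-continuous jumps times continuous functions, which yields both its path
regularity and its continuity in the data. -/
theorem centeredDetector_eq_sum_indicator (Om : Fin 3 → ℝ) (s₀ : ℝ) (τ : Fin 3 → ℕ → ℝ)
    (n : Fin 3 → ℕ) (y : (Fin 3 → ℕ) → ℝ) {x : Fin 4 → ℝ} (hx : x 0 ∈ Set.Icc (0 : ℝ) 1) :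
    centeredDetector Om s₀ τ n y x = ∑ l ∈ grid n,
      (if (l 0 : ℝ) / n 0 ≤ x 0 then (1 : ℝ) else 0) * (Real.sqrt (∏ j, τ j (n j)) *
        centeredArray s₀ n y l *
          reconstructionKernel Om (fun j => x j.succ - samplingPoint τ n l j)) := by
  have hfilter : grid ![⌊(n 0 : ℝ) * x 0⌋₊, n 1, n 2] =
      (grid n).filter fun l => (l 0 : ℝ) / n 0 ≤ x 0 := by
    ext l
    simp only [grid, Finset.mem_filter, Fintype.mem_piFinset, Fin.forall_fin_succ, Finset.mem_Icc,
      Matrix.cons_val_zero, Matrix.cons_val_succ, IsEmpty.forall_iff, and_true]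
    have hfl : ⌊(n 0 : ℝ) * x 0⌋₊ ≤ n 0 := by
      refine (Nat.floor_le_floor (mul_le_of_le_one_right (Nat.cast_nonneg _) hx.2)).trans ?_
      rw [Nat.floor_natCast]
    have hiff : 1 ≤ n 0 → ((l 0 : ℝ) / n 0 ≤ x 0 ↔ l 0 ≤ ⌊(n 0 : ℝ) * x 0⌋₊) := fun h => by
      have : (0 : ℝ) < n 0 := Nat.cast_pos.2 h
      rw [Nat.le_floor_iff (mul_nonneg this.le hx.1), div_le_iff₀ this, mul_comm]
    constructor
    · rintro ⟨⟨h1, h2⟩, h3⟩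
      exact ⟨⟨⟨h1, h2.trans hfl⟩, h3⟩, (hiff (h1.trans (h2.trans hfl))).2 h2⟩
    · rintro ⟨⟨⟨h1, h2⟩, h3⟩, h4⟩
      exact ⟨⟨h1, (hiff (h1.trans h2)).1 h4⟩, h3⟩
  rw [centeredDetector_eq_sum, hfilter, Finset.sum_filter, Finset.mul_sum]
  refine Finset.sum_congr rfl fun l _ => ?_
  split_ifs <;> ring

theorem isPath_centeredDetector (Om : Fin 3 → ℝ) {s₀ : ℝ} (hs₀ : 0 ≤ s₀) (τ : Fin 3 → ℕ → ℝ)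
    (τbar : Fin 3 → ℝ) (n : Fin 3 → ℕ) (y : (Fin 3 → ℕ) → ℝ) :
    SkorokhodSpace.IsPath
      fun x : RectBox ![s₀, 0, 0, 0] ![1, τbar 0, τbar 1, τbar 2] =>
        centeredDetector Om s₀ τ n y fun p => (x p : ℝ) := by
  have hx : ∀ x : RectBox ![s₀, 0, 0, 0] ![1, τbar 0, τbar 1, τbar 2],
      (x 0 : ℝ) ∈ Set.Icc (0 : ℝ) 1 := fun x => ⟨hs₀.trans (x 0).2.1, (x 0).2.2⟩
  simp only [fun x => centeredDetector_eq_sum_indicator Om s₀ τ n y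
    (x := fun p => (x p : ℝ)) (hx x)]
  refine SkorokhodSpace.isPath_sum _ fun l _ =>
    (SkorokhodSpace.isPath_indicator_le 0 _).mul (SkorokhodSpace.isPath_of_continuous ?_)
  refine continuous_const.mul ((continuous_reconstructionKernel Om).comp ?_)
  exact continuous_pi fun j =>
    (continuous_subtype_val.comp (continuous_apply j.succ)).sub continuous_const

/-- The path of the centered detector. -/
def detectorPath (Om : Fin 3 → ℝ) {s₀ : ℝ} (hs₀ : 0 ≤ s₀) (τ : Fin 3 → ℕ → ℝ)
    (τbar : Fin 3 → ℝ) (n : Fin 3 → ℕ) (y : (Fin 3 → ℕ) → ℝ) :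
    SkorokhodSpace ![s₀, 0, 0, 0] ![1, τbar 0, τbar 1, τbar 2] :=
  .ofPath _ (isPath_centeredDetector Om hs₀ τ τbar n y)

theorem detectorPath_apply (Om : Fin 3 → ℝ) {s₀ : ℝ} (hs₀ : 0 ≤ s₀) (τ : Fin 3 → ℕ → ℝ)
    (τbar : Fin 3 → ℝ) (n : Fin 3 → ℕ) (y : (Fin 3 → ℕ) → ℝ)
    (x : RectBox ![s₀, 0, 0, 0] ![1, τbar 0, τbar 1, τbar 2]) :
    detectorPath Om hs₀ τ τbar n y x = centeredDetector Om s₀ τ n y fun p => (x p : ℝ) := rfl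

theorem continuous_centeredArray (s₀ : ℝ) (n l : Fin 3 → ℕ) :
    Continuous fun y => centeredArray s₀ n y l := by
  unfold centeredArray learningAverage
  fun_prop

/-- This provides measurability for the Borel σ-algebra of the Skorokhod space. Finitely many
centered observations enter linearly with bounded kernels, so convergence of the data in the product
topology gives uniform convergence of the paths. -/
theorem continuous_detectorPath (Om : Fin 3 → ℝ) {s₀ : ℝ} (hs₀ : 0 ≤ s₀) (τ : Fin 3 → ℕ → ℝ)
    (τbar : Fin 3 → ℝ) (n : Fin 3 → ℕ) : Continuous (detectorPath Om hs₀ τ τbar n) := by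
  refine continuous_iff_continuousAt.2 fun y =>
    SkorokhodSpace.tendsto_of_forall_abs_sub_le fun c hc => ?_
  have hlim : Tendsto (fun y' => ∑ l ∈ grid n, Real.sqrt (∏ j, τ j (n j)) *
      |centeredArray s₀ n y' l - centeredArray s₀ n y l| * ∏ j, |Om j / Real.pi|) (𝓝 y) (𝓝 0) := by
    have hcont : Continuous fun y' => ∑ l ∈ grid n, Real.sqrt (∏ j, τ j (n j)) *
        |centeredArray s₀ n y' l - centeredArray s₀ n y l| * ∏ j, |Om j / Real.pi| :=
      continuous_finsetSum _ fun l _ => (continuous_const.mul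
        ((continuous_centeredArray s₀ n l).sub continuous_const).abs).mul continuous_const
    simpa using hcont.tendsto y
  filter_upwards [hlim.eventually (gt_mem_nhds hc)] with y' hy' x
  have hx : (x 0 : ℝ) ∈ Set.Icc (0 : ℝ) 1 := ⟨hs₀.trans (x 0).2.1, (x 0).2.2⟩
  rw [detectorPath_apply, detectorPath_apply, centeredDetector_eq_sum_indicator Om s₀ τ n y' hx,
    centeredDetector_eq_sum_indicator Om s₀ τ n y hx, ← Finset.sum_sub_distrib]
  refine (Finset.abs_sum_le_sum_abs _ _).trans ((Finset.sum_le_sum fun l _ => ?_).trans hy'.le)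
  rw [← mul_sub, ← sub_mul, ← mul_sub, abs_mul, abs_mul, abs_mul,
    abs_of_nonneg (Real.sqrt_nonneg _)]
  refine (mul_le_of_le_one_left (by positivity) ?_).trans
    (mul_le_mul_of_nonneg_left (abs_reconstructionKernel_le _ _) (by positivity))
  split_ifs <;> simp

/-- Under the null hypothesis with a time-constant reference signal, the signal cancels in the
centered observations. -/
theorem centeredArray_observation {Ω : Type*} {s₀ : ℝ} (hs₁ : s₀ ≤ 1) {τ : Fin 3 → ℕ → ℝ}
    {τbar : Fin 3 → ℝ} {f f₀ : (Fin 3 → ℝ) → ℝ} (hH₀ : ∀ x ∈ signalDomain τbar τ, f x = f₀ x)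
    (hconst : ∀ x ∈ signalDomain τbar τ, f₀ x = f₀ (Function.update x 0 0))
    (ε : (Fin 3 → ℤ) → Ω → ℝ) {n : Fin 3 → ℕ} (hn : 0 < ⌊(n 0 : ℝ) * s₀⌋₊) (ω : Ω)
    {l : Fin 3 → ℕ} (hl : l ∈ grid n) :
    centeredArray s₀ n (observation f ε τ n ω) l =
      centeredArray s₀ n (fun i => ε (fun j => (i j : ℤ)) ω) l := by
  have hmem : ∀ l ∈ grid n,
      f (samplingPoint τ n l) = f₀ (Function.update (samplingPoint τ n l) 0 0) := fun l hl => by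
    have : samplingPoint τ n l ∈ signalDomain τbar τ := Or.inr ⟨n, l, hl, rfl⟩
    rw [hH₀ _ this, hconst _ this]
  have hfl : ⌊(n 0 : ℝ) * s₀⌋₊ ≤ n 0 := by
    refine (Nat.floor_le_floor (mul_le_of_le_one_right (Nat.cast_nonneg _) hs₁)).trans ?_
    rw [Nat.floor_natCast]
  have hf : ∀ k ∈ Finset.Icc 1 ⌊(n 0 : ℝ) * s₀⌋₊,
      f (samplingPoint τ n (Function.update l 0 k)) = f (samplingPoint τ n l) := fun k hk => by
    have hk' : Function.update l 0 k ∈ grid n := by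
      refine Fintype.mem_piFinset.2 fun j => ?_
      rcases eq_or_ne j 0 with rfl | hj
      · rw [Function.update_self]
        exact Finset.Icc_subset_Icc le_rfl hfl hk
      · rw [Function.update_of_ne hj]
        exact Fintype.mem_piFinset.1 hl j
    rw [hmem _ hk', hmem _ hl]
    congr 1
    funext j
    rcases eq_or_ne j 0 with rfl | hj
    · simp
    · simp [samplingPoint, hj]
  -- The cancellation needs a nonempty learning sample: otherwise the average is `0` by default and
  -- the signal survives.
  have hK : (⌊(n 0 : ℝ) * s₀⌋₊ : ℝ) ≠ 0 := Nat.cast_ne_zero.2 hn.ne'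
  simp only [centeredArray, learningAverage, observation, Finset.sum_add_distrib]
  rw [Finset.sum_congr rfl hf, Finset.sum_const, Nat.card_Icc, Nat.add_sub_cancel, nsmul_eq_mul]
  field_simp
  ring

theorem centeredDetector_observation {Ω : Type*} (Om : Fin 3 → ℝ) {s₀ : ℝ} (hs₁ : s₀ ≤ 1)
    {τ : Fin 3 → ℕ → ℝ}
    {τbar : Fin 3 → ℝ} {f f₀ : (Fin 3 → ℝ) → ℝ} (hH₀ : ∀ x ∈ signalDomain τbar τ, f x = f₀ x)
    (hconst : ∀ x ∈ signalDomain τbar τ, f₀ x = f₀ (Function.update x 0 0))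
    (ε : (Fin 3 → ℤ) → Ω → ℝ) {n : Fin 3 → ℕ} (hn : 0 < ⌊(n 0 : ℝ) * s₀⌋₊) (ω : Ω)
    {x : Fin 4 → ℝ} (hx : x 0 ∈ Set.Icc (0 : ℝ) 1) :
    centeredDetector Om s₀ τ n (observation f ε τ n ω) x =
      centeredDetector Om s₀ τ n (fun i => ε (fun j => (i j : ℤ)) ω) x := by
  rw [centeredDetector_eq_sum_indicator Om s₀ τ n _ hx,
    centeredDetector_eq_sum_indicator Om s₀ τ n _ hx]
  refine Finset.sum_congr rfl fun l hl => ?_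
  rw [centeredArray_observation hs₁ hH₀ hconst ε hn ω hl]

/-! ### The limit process -/

/-- The projection of a point onto the unit cube. -/
def projUnitCube {q : ℕ} (z : Fin q → ℝ) : RectBox (0 : Fin q → ℝ) 1 :=
  fun j => Set.projIcc 0 1 zero_le_one (z j)

theorem continuous_projUnitCube {q : ℕ} : Continuous (projUnitCube (q := q)) :=
  continuous_pi fun j => continuous_projIcc.comp (continuous_apply (A := fun _ => ℝ) j)

theorem projUnitCube_coe {q : ℕ} {z : Fin q → ℝ} (hz : z ∈ Set.Icc (0 : Fin q → ℝ) 1) (j : Fin q) :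
    (projUnitCube z j : ℝ) = z j :=
  congrArg Subtype.val (Set.projIcc_of_mem zero_le_one ⟨hz.1 j, hz.2 j⟩)

theorem continuous_kernelIntegral_rectBox (Om : Fin 3 → ℝ) {s₀ : ℝ} (hs₀ : 0 < s₀)
    (τbar : Fin 3 → ℝ) {h : (Fin 3 → ℝ) → ℝ} (hh : Continuous h) :
    Continuous fun x : RectBox ![s₀, 0, 0, 0] ![1, τbar 0, τbar 1, τbar 2] =>
      kernelIntegral Om h (τbar, fun p => (x p : ℝ)) := by
  refine (continuousOn_kernelIntegral Om hh).comp_continuous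
    (f := fun x : RectBox ![s₀, 0, 0, 0] ![1, τbar 0, τbar 1, τbar 2] =>
      ((τbar, fun p => (x p : ℝ)) : (Fin 3 → ℝ) × (Fin 4 → ℝ))) ?_
    fun x => hs₀.trans_le (x 0).2.1
  exact continuous_const.prodMk
    (continuous_pi fun p => continuous_subtype_val.comp (continuous_apply p))

/-- The path of the limit process, as a function of the continuous limit of the partial sums. -/
def limitPath (Om : Fin 3 → ℝ) {s₀ : ℝ} (hs₀ : 0 < s₀) (τbar : Fin 3 → ℝ)
    (g : {g : SkorokhodSpace (0 : Fin 3 → ℝ) 1 // Continuous g.toFun}) :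
    SkorokhodSpace ![s₀, 0, 0, 0] ![1, τbar 0, τbar 1, τbar 2] :=
  .ofPath _ (SkorokhodSpace.isPath_of_continuous (continuous_kernelIntegral_rectBox Om hs₀ τbar
    (continuous_bridgedSheet s₀ (g.2.comp continuous_projUnitCube))))

theorem limitPath_apply (Om : Fin 3 → ℝ) {s₀ : ℝ} (hs₀ : s₀ ∈ Set.Ioo (0 : ℝ) 1)
    (τbar : Fin 3 → ℝ) (g : {g : SkorokhodSpace (0 : Fin 3 → ℝ) 1 // Continuous g.toFun})
    {h : (Fin 3 → ℝ) → ℝ} (hg : ∀ x : RectBox (0 : Fin 3 → ℝ) 1, g.1 x = h fun p => (x p : ℝ))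
    (x : RectBox ![s₀, 0, 0, 0] ![1, τbar 0, τbar 1, τbar 2]) :
    limitPath Om hs₀.1 τbar g x =
      kernelIntegral Om (bridgedSheet s₀ h) (τbar, fun p => (x p : ℝ)) := by
  refine kernelIntegral_congr Om ⟨hs₀.1.le.trans (x 0).2.1, (x 0).2.2⟩
    (bridgedSheet_congr ⟨hs₀.1.le, hs₀.2.le⟩ fun z hz => (hg _).trans ?_)
  exact congrArg h (funext fun j => projUnitCube_coe hz j)

/-- This makes the limit a random element. On the subspace of continuous paths Skorokhod closeness
is uniform closeness, and the Lipschitz bound applies. -/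
theorem continuous_limitPath (Om : Fin 3 → ℝ) {s₀ : ℝ} (hs₀ : s₀ ∈ Set.Ioo (0 : ℝ) 1)
    (τbar : Fin 3 → ℝ) : Continuous (limitPath Om hs₀.1 τbar) := by
  refine continuous_iff_continuousAt.2 fun g =>
    SkorokhodSpace.tendsto_of_forall_abs_sub_le fun c hc => ?_
  set S : Set ((Fin 3 → ℝ) × (Fin 4 → ℝ)) :=
    {τbar} ×ˢ Set.Icc ![s₀, 0, 0, 0] ![1, τbar 0, τbar 1, τbar 2]
  obtain ⟨L, hL, hLip⟩ := exists_abs_kernelIntegral_sub_le Om (S := S)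
    (isCompact_singleton.prod isCompact_Icc)
    (fun p hp => ⟨hs₀.1.le.trans (hp.2.1 0), hp.2.2 0⟩)
    (continuous_bridgedSheet s₀ (g.2.comp continuous_projUnitCube))
  have hinv : 0 < 1 / s₀ := one_div_pos.2 hs₀.1
  -- Bridging enlarges a uniform error by at most `1 + 1 / s₀`, the integral by at most `L`.
  obtain ⟨U, hU, hgU, hUc⟩ := SkorokhodSpace.exists_forall_abs_sub_le g.2
    (c := c / (L * (1 + 1 / s₀))) (by positivity)
  filter_upwards [continuous_subtype_val.continuousAt.preimage_mem_nhds (hU.mem_nhds hgU)]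
    with g' hg' x
  have hs : s₀ ∈ Set.Icc (0 : ℝ) 1 := ⟨hs₀.1.le, hs₀.2.le⟩
  refine (hLip (τbar, fun p => (x p : ℝ))
    ⟨rfl, fun p => (x p).2.1, fun p => (x p).2.2⟩ _ (c / L)
    (continuous_bridgedSheet s₀ (g'.2.comp continuous_projUnitCube)).measurable
    (by positivity) fun z hz => ?_).trans_eq (by field_simp)
  have h1 := hUc _ hg' (projUnitCube z)
  have h2 := hUc _ hg' (projUnitCube (Function.update z 0 s₀))
  have h3 : |z 0 / s₀| ≤ 1 / s₀ := by
    rw [abs_of_nonneg (div_nonneg (hz.1 0) hs₀.1.le)]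
    exact div_le_div_of_nonneg_right (hz.2 0) hs₀.1.le
  have e : ∀ a b c d r : ℝ, a - r * b - (c - r * d) = (a - c) - r * (b - d) :=
    fun _ _ _ _ _ => by ring
  rw [bridgedSheet, bridgedSheet, e]
  refine (abs_sub _ _).trans ?_
  rw [abs_mul]
  refine (add_le_add h1 (mul_le_mul h3 h2 (abs_nonneg _) hinv.le)).trans_eq ?_
  field_simp

theorem bridgedSheet_const_mul (s₀ c : ℝ) (h : (Fin 3 → ℝ) → ℝ) :
    bridgedSheet s₀ (fun z => c * h z) = fun z => c * bridgedSheet s₀ h z := by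
  funext z
  simp only [bridgedSheet]
  ring

/-- Bridging preserves continuity and the vanishing on the lower faces: on `z 0 = 0` the factor `z 0
/ s₀` vanishes, and any other zero coordinate survives the update of the first one. -/
theorem hasIntegralByParts_reconstructionKernel (Om τbar : Fin 3 → ℝ) {s₀ : ℝ}
    (hs₀ : s₀ ∈ Set.Ioo (0 : ℝ) 1) {h : (Fin 3 → ℝ) → ℝ} (hh : ContinuousOn h (Set.Icc 0 1))
    (hzero : ∀ z ∈ Set.Icc (0 : Fin 3 → ℝ) 1, (∃ j, z j = 0) → h z = 0) {s : ℝ}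
    (hs : s ∈ Set.Icc s₀ 1) (t r₂ r₃ : ℝ) :
    HasIntegralByParts 0 ![s, 1, 1]
      (fun z => reconstructionKernel Om
        ![t - τbar 0 * z 0, r₂ - τbar 1 * z 1, r₃ - τbar 2 * z 2])
      (bridgedSheet s₀ h)
      (byPartsIntegral (shiftedFactor Om (τbar, ![s, t, r₂, r₃]))
        (shiftedFactorDeriv Om (τbar, ![s, t, r₂, r₃])) ![s, 1, 1] (bridgedSheet s₀ h)) := by
  have hs' : s₀ ∈ Set.Icc (0 : ℝ) 1 := ⟨hs₀.1.le, hs₀.2.le⟩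
  obtain ⟨k, hk, hkh⟩ := exists_continuous_eqOn_Icc hh
  have hb0 : (0 : Fin 3 → ℝ) ≤ ![s, 1, 1] := by
    intro j
    fin_cases j
    exacts [hs₀.1.le.trans hs.1, zero_le_one, zero_le_one]
  have hb1 : ![s, 1, 1] ≤ (1 : Fin 3 → ℝ) := by
    intro j
    fin_cases j
    exacts [hs.2, le_rfl, le_rfl]
  have hsub : Set.Icc (0 : Fin 3 → ℝ) ![s, 1, 1] ⊆ Set.Icc 0 1 := Set.Icc_subset_Icc le_rfl hb1
  have hkernel : (fun z : Fin 3 → ℝ => reconstructionKernel Om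
      ![t - τbar 0 * z 0, r₂ - τbar 1 * z 1, r₃ - τbar 2 * z 2]) =
      fun z => ∏ j, shiftedFactor Om (τbar, ![s, t, r₂, r₃]) j (z j) := by
    funext z
    rw [reconstructionKernel_eq_prod, Fin.prod_univ_three, Fin.prod_univ_three]
    rfl
  rw [hkernel]
  refine hasIntegralByParts_byPartsIntegral hb0 ?_ ?_ (hasDerivAt_shiftedFactor Om _)
    (continuous_shiftedFactorDeriv_right Om _)
  · exact (continuous_bridgedSheet s₀ hk).continuousOn.congr fun z hz =>
      bridgedSheet_congr hs' (fun z hz => (hkh z hz).symm) z (hsub hz)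
  · rintro z hz ⟨j, hj⟩
    rw [bridgedSheet, hzero z (hsub hz) ⟨j, hj⟩, zero_sub, neg_eq_zero]
    rcases eq_or_ne j 0 with rfl | hj0
    · rw [hj, zero_div, zero_mul]
    · rw [hzero _ (update_mem_Icc hs' (hsub hz)) ⟨j, by rw [Function.update_of_ne hj0, hj]⟩,
        mul_zero]

end

/-! ### Weak convergence of the centered detector -/

theorem mainTheorem4
    {Ω Ω' : Type*} [MeasurableSpace Ω] [MeasurableSpace Ω']
    (P : Measure Ω) [IsProbabilityMeasure P] (P' : Measure Ω') [IsProbabilityMeasure P']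
    -- the kernel parameters, the end of the learning period, the sampling periods
    (Om : Fin 3 → ℝ) (hOm : ∀ j, 0 < Om j)
    (s₀ : ℝ) (hs₀ : s₀ ∈ Set.Ioo (0 : ℝ) 1)
    (τ : Fin 3 → ℕ → ℝ) (hτ : ∀ j m, 0 < τ j m)
    (τbar : Fin 3 → ℝ) (hτbar : ∀ j, 0 < τbar j)
    (hτlim : ∀ j, Tendsto (fun m : ℕ => (m : ℝ) * τ j m) atTop (𝓝 (τbar j)))
    -- the noise: weakly stationary, centered, satisfying a functional central limit theorem
    (ε : (Fin 3 → ℤ) → Ω → ℝ) (hstat : IsWeaklyStationary P ε) (hmean : ∀ i, P[ε i] = 0)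
    (B : Ω' → (Fin 3 → ℝ) → ℝ) (hB : IsBrownianSheet P' B)
    (σ : ℝ) (hσ : 0 < σ)
    (hFCLT : ConvergesWeaklyInSkorokhod (0 : Fin 3 → ℝ) 1 P P'
      (partialSumProcess ε) atTop (fun ω v => σ * B ω v))
    -- the null hypothesis, with a time-constant reference signal
    (f f₀ : (Fin 3 → ℝ) → ℝ)
    (hH₀ : ∀ x ∈ signalDomain τbar τ, f x = f₀ x)
    (hconst : ∀ x ∈ signalDomain τbar τ, f₀ x = f₀ (Function.update x 0 0)) :
    ∃ Fc : Ω' → (Fin 4 → ℝ) → ℝ,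
      (∀ᵐ ω ∂P', ∀ s t r₂ r₃ : ℝ, s ∈ Set.Icc s₀ 1 → t ∈ Set.Icc 0 (τbar 0) →
        r₂ ∈ Set.Icc 0 (τbar 1) → r₃ ∈ Set.Icc 0 (τbar 2) →
        ∃ I : ℝ,
          HasIntegralByParts 0 ![s, 1, 1]
            (fun z => reconstructionKernel Om
              ![t - τbar 0 * z 0, r₂ - τbar 1 * z 1, r₃ - τbar 2 * z 2])
            (bridgedSheet s₀ (B ω)) I ∧
          Fc ω ![s, t, r₂, r₃] = Real.sqrt (τbar 0 * τbar 1 * τbar 2) * σ * I) ∧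
      ConvergesWeaklyInSkorokhod ![s₀, 0, 0, 0] ![1, τbar 0, τbar 1, τbar 2] P P'
        (fun n ω => centeredDetector Om s₀ τ n (observation f ε τ n ω)) atTop Fc := by
  obtain ⟨Z, W, hZ, hW, hZW⟩ := hFCLT
  refine ⟨fun ω x => kernelIntegral Om (bridgedSheet s₀ fun v => σ * B ω v) (τbar, x), ?_, ?_⟩
  · filter_upwards [hB.continuous_paths, hB.zero_on_faces] with ω hcont hzero s t r₂ r₃ hs _ _ _
    refine ⟨_, hasIntegralByParts_reconstructionKernel Om τbar hs₀ hcont hzero hs t r₂ r₃, ?_⟩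
    rw [bridgedSheet_const_mul, kernelIntegral, byPartsIntegral_const_mul, Fin.prod_univ_three,
      mul_assoc (Real.sqrt _) σ]
    rfl
  have hWcont : ∀ᵐ ω ∂P', Continuous (W ω).toFun := by
    filter_upwards [hB.continuous_paths, hW] with ω hcont hWω
    rw [show (W ω).toFun = fun x => σ * B ω fun p => (x p : ℝ) from funext hWω]
    refine continuous_const.mul (hcont.comp_continuous (continuous_pi fun p =>
      continuous_subtype_val.comp (continuous_apply p)) fun x => ?_)
    exact ⟨fun p => (x p).2.1, fun p => (x p).2.2⟩
  -- `limitPath` accepts continuous elements only, so the almost surely continuous limit is replaced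
  -- by a measurable version that is continuous everywhere, with the zero path certifying that the
  -- target set is nonempty.
  obtain ⟨V, hVm, hVr, hWV⟩ := hZW.aemeasurable_limit.exists_ae_eq_range_subset
    (t := {g | Continuous g.toFun}) hWcont
    ⟨.ofPath (fun _ => 0) (SkorokhodSpace.isPath_of_continuous continuous_const),
      continuous_const⟩
  have hVc : ∀ ω, Continuous (V ω).toFun := fun ω => hVr ⟨ω, rfl⟩
  have hlimit : ∀ᵐ ω ∂P', ∀ x, limitPath Om hs₀.1 τbar ⟨V ω, hVc ω⟩ x =
      kernelIntegral Om (bridgedSheet s₀ fun v => σ * B ω v) (τbar, fun p => (x p : ℝ)) := by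
    filter_upwards [hW, hWV] with ω hWω hWVω x
    refine limitPath_apply Om hs₀ τbar ⟨V ω, hVc ω⟩ (h := fun v => σ * B ω v) (fun x => ?_) x
    rw [← hWω, hWVω]
  refine ⟨fun n ω => detectorPath Om hs₀.1.le τ τbar n (observation f ε τ n ω),
    fun ω => limitPath Om hs₀.1 τbar ⟨V ω, hVc ω⟩, fun n => Eventually.of_forall fun ω x => rfl,
    hlimit, ?_⟩
  -- The almost sure events are those on which the random elements `Z n` coincide with the partial
  -- sum paths.
  refine tendstoInDistribution_of_forall_isOpen hZW (fun n => ?_) ?_ hZ ?_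
  · refine (continuous_detectorPath Om hs₀.1.le τ τbar n).measurable.comp_aemeasurable
      (aemeasurable_pi_lambda _ fun l => ?_)
    exact ((hstat.memLp _).aestronglyMeasurable.aemeasurable).const_add _
  · exact ((continuous_limitPath Om hs₀ τbar).measurable.comp hVm.subtype_mk).aemeasurable
  · filter_upwards [hB.continuous_paths, hW, hWcont, hlimit] with ω' hcont hWω hWc hlim G hG hmem
    obtain ⟨r, hr, hrG⟩ := EMetric.isOpen_iff.1 hG _ hmem
    obtain ⟨η, hη, hηr⟩ := ENNReal.lt_iff_exists_real_btwn.1 hr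
    have hη0 : 0 < η := ENNReal.ofReal_pos.1 hηr.1
    obtain ⟨δ, hδ, hδ'⟩ := exists_abs_centeredDetector_sub_le Om hs₀ hτlim
      (h := fun v => σ * B ω' v) (continuousOn_const.mul hcont) hη0
    obtain ⟨U, hU, hWU, hUδ⟩ := SkorokhodSpace.exists_forall_abs_sub_le hWc hδ
    refine ⟨U, hU, hWU, ?_⟩
    -- The second condition is used only for `0 < ⌊n₁ s₀⌋`, which lets the signal cancel; its
    -- tolerance is arbitrary.
    filter_upwards [hδ', (tendsto_apply_atTop (0 : Fin 3)).eventually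
      (eventually_abs_floor_div_floor_sub_le hs₀.1 hs₀.2.le one_pos)] with n hn hn0 ω hω hωU
    refine hrG ((SkorokhodSpace.edist_le_of_forall_abs_sub_le fun x => ?_).trans_lt hηr.2)
    rw [hlim, detectorPath_apply, centeredDetector_observation Om hs₀.2.le hH₀ hconst ε hn0.1 ω
      ⟨hs₀.1.le.trans (x 0).2.1, (x 0).2.2⟩]
    refine hn _ (fun z hz => ?_) _ ⟨fun p => (x p).2.1, fun p => (x p).2.2⟩
    have key := hUδ _ hωU (projUnitCube z)
    have hproj : (fun p => (projUnitCube z p : ℝ)) = z := funext fun j => projUnitCube_coe hz j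
    rw [hω, hWω, hproj] at key
    -- The partial sum process is by definition the normalized `stepSum` of the noise array.
    exact key
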